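/- Let $d\ge 1$. For $\omega=(\omega_j)_{j\in\mathbb Z}\in(\{0,1\}^d)^{\mathbb Z}$ let $$\mathscr D=\mathscr D^{\omega}=\Big\{2^{-k}([0,1)^d+m)+\sum_{j>k}2^{-j}\omega_j:\ k\in\mathbb Z,\ m\in\mathbb Z^d\Big\}$$ be the associated dyadic system; write $\ell(I)$ for the side length and $|I|$ for the Lebesgue measure of a cube $I$. For an interval $I$ with left and right halves $I_\ell,I_r$ put $h_I^0=|I|^{-1/2}1_I$ and $h_I^1=|I|^{-1/2}(1_{I_\ell}-1_{I_r})$, and for a cube $I=I_1\times\cdots\times I_d$ and $\eta\in\{0,1\}^d$ let $h_I^\eta(x)=\prod_{r=1}^d h_{I_r}^{\eta_r}(x_r)$ be the Haar functions. Put $\langle f,h\rangle=\int fh\,dx$. For $i,j\in\{0,1,2,\dots\}$, a dyadic shift of type $(i,j)$ on $\mathscr D$ is an operator $S=\sum_{K\in\mathscr D}A_K$ with $$A_Kf=\sum_{\substack{I,J\in\mathscr D;\ I,J\subseteq K\\ \ell(I)=2^{-i}\ell(K),\ \ell(J)=2^{-j}\ell(K)}}\ \sum_{\eta,\theta\in\{0,1\}^d}a_{IJK}^{\eta\theta}\,\langle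 f,h_I^\eta\rangle\,h_J^\theta,\qquad a^{\eta\theta}_{IJK}\in\mathbb C,\quad |a_{IJK}^{\eta\theta}|\le\frac{\sqrt{|I||J|}}{|K|},$$ such that for every $\mathscr Q\subseteq\mathscr D$ the series $\sum_{K\in\mathscr Q}A_Kf$ converges unconditionally in $L^2(\mathbb R^d)$ for all $f\in L^2(\mathbb R^d)$, with sum of $L^2$ norm at most $\|f\|_{L^2}$. For nonnegative locally integrable functions $w,\sigma$ on $\mathbb R^d$ write $w(E)=\int_E w\,dx$, identify $w$ with the measure $w\,dx$, and put $$[w,\sigma]_{A_2}=\sup_{Q\in\mathscr D}\frac{w(Q)\sigma(Q)}{|Q|^2},\qquad [w]_{A_\infty}=\sup_{Q\in\mathscr D,\,w(Q)>0}\frac1{w(Q)}\int_QM(w1_Q)\,dx\quad(=0\text{ if }w=0\text{ a.e.}),$$ where $M(w1_Q)(x)=\sup_{R\in\mathscr D,\,R\ni x}|R|^{-1}w(R\cap Q)$ is the dyadic maximal function; $w\in A_\infty$ means $[w]_{A_\infty}<\infty$. Theorem. There is a constant $C=C(d)$, depending only on the dimension $d$, such that for every dyadic system $\mathscr D=\mathscr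 D^\omega$, every dyadic shift $S$ of type $(i,j)$ on $\mathscr D$, and all nonnegative locally integrable $\sigma,w\in A_\infty$ with $[w,\sigma]_{A_2}<\infty$ the following holds. For every $f\in L^2(\sigma)$ the series $S(\sigma f)=\sum_{K\in\mathscr D}A_K(\sigma f)$ converges unconditionally in $L^2(w)$, and it defines a bounded linear operator $S(\sigma\,\cdot):L^2(\sigma)\to L^2(w)$ with $$\|S(\sigma\,\cdot)\|_{L^2(\sigma)\to L^2(w)}\le C\,(1+\kappa)^2\,[w,\sigma]_{A_2}^{1/2}\big([w]_{A_\infty}^{1/2}+[\sigma]_{A_\infty}^{1/2}\big),\qquad \kappa=\max\{i,j\}.$$ -/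

import Mathlib

open MeasureTheory Filter Topology
open scoped ENNReal NNReal

namespace DyadicShift

/-- The label of a cube of a dyadic system in `ℝ^d`: its generation `scale = k` (the side length
is `2^(-k)`) and its position `index = m ∈ ℤ^d` among the cubes of that generation. -/
structure DyadicCube (d : ℕ) where
  scale : ℤ
  index : Fin d → ℤ

/-- The side length `2^(-k)`. -/
noncomputable def DyadicCube.sideLength {d : ℕ} (Q : DyadicCube d) : ℝ := (2 : ℝ) ^ (-Q.scale)

/-- The translation `∑_{j > k} 2^(-j) ω_j` of the cubes of generation `k`, for a parameter
`ω = (ω_j)_{j ∈ ℤ}` with `ω_j ∈ {0,1}^d`. The summation index is `j = k + 1 + n`, `n ∈ ℕ`. -/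
noncomputable def offset {d : ℕ} (ω : ℤ → Fin d → Fin 2) (k : ℤ) (r : Fin d) : ℝ :=
  ∑' n : ℕ, (2 : ℝ) ^ (-(k + 1 + (n : ℤ))) * ((ω (k + 1 + (n : ℤ)) r : ℕ) : ℝ)

/-- The lower left corner of the cube labelled `Q` in the dyadic system `𝒟^ω`. -/
noncomputable def DyadicCube.corner {d : ℕ} (ω : ℤ → Fin d → Fin 2) (Q : DyadicCube d)
    (r : Fin d) : ℝ :=
  Q.sideLength * (Q.index r : ℝ) + offset ω Q.scale r

/-- The cube `2^(-k) ([0,1)^d + m) + ∑_{j > k} 2^(-j) ω_j` of the dyadic system `𝒟^ω`. -/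
def DyadicCube.toSet {d : ℕ} (ω : ℤ → Fin d → Fin 2) (Q : DyadicCube d) : Set (Fin d → ℝ) :=
  {x | ∀ r, Q.corner ω r ≤ x r ∧ x r < Q.corner ω r + Q.sideLength}

lemma DyadicCube.sideLength_pos {d : ℕ} (Q : DyadicCube d) : 0 < Q.sideLength := by
  unfold DyadicCube.sideLength
  positivity

lemma DyadicCube.corner_mem {d : ℕ} (ω : ℤ → Fin d → Fin 2) (Q : DyadicCube d) :
    Q.corner ω ∈ Q.toSet ω :=
  fun r => ⟨le_refl _, by linarith [Q.sideLength_pos]⟩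

lemma finite_descendants {d : ℕ} (ω : ℤ → Fin d → Fin 2) (i : ℕ) (K : DyadicCube d) :
    {I : DyadicCube d | I.scale = K.scale + i ∧ I.toSet ω ⊆ K.toSet ω}.Finite := by
  set l : ℝ := (2 : ℝ) ^ (-(K.scale + (i : ℤ))) with hl
  have hl0 : 0 < l := by positivity
  set s : Fin d → ℝ := offset ω (K.scale + i) with hs
  set lo : Fin d → ℤ := fun r => ⌊(K.corner ω r - s r) / l⌋ with hlo
  set hi : Fin d → ℤ := fun r => ⌈(K.corner ω r + K.sideLength - s r) / l⌉ with hhi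
  refine Set.Finite.subset
    ((Set.finite_Icc lo hi).image (fun m => (⟨K.scale + i, m⟩ : DyadicCube d))) ?_
  rintro ⟨k, m⟩ ⟨hk, hsub⟩
  obtain rfl : k = K.scale + i := hk
  refine ⟨m, ?_, rfl⟩
  have h := hsub (DyadicCube.corner_mem ω ⟨K.scale + i, m⟩)
  have hc : ∀ r, DyadicCube.corner ω ⟨K.scale + i, m⟩ r = l * (m r : ℝ) + s r := fun r => rfl
  refine ⟨fun r => ?_, fun r => ?_⟩
  · have h1 := (h r).1
    rw [hc] at h1
    have h2 : (K.corner ω r - s r) / l ≤ (m r : ℝ) := by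
      rw [div_le_iff₀ hl0]; linarith
    exact_mod_cast (Int.floor_le _).trans h2
  · have h1 := (h r).2
    rw [hc] at h1
    have h2 : (m r : ℝ) ≤ (K.corner ω r + K.sideLength - s r) / l := by
      rw [le_div_iff₀ hl0]; linarith
    exact_mod_cast h2.trans (Int.le_ceil _)

/-- The (finitely many) cubes `I ∈ 𝒟^ω` with `I ⊆ K` and `ℓ(I) = 2^(-i) ℓ(K)`. -/
noncomputable def descendants {d : ℕ} (ω : ℤ → Fin d → Fin 2) (i : ℕ) (K : DyadicCube d) :
    Finset (DyadicCube d) :=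
  (finite_descendants ω i K).toFinset

/-- The two Haar functions of the interval `[c, c + l)`: the non-cancellative
`l^(-1/2) 1_[c, c+l)` for `e = 0`, and the cancellative
`l^(-1/2) (1_[c, c+l/2) - 1_[c+l/2, c+l))` for `e = 1`. -/
noncomputable def haar1 (c l : ℝ) (e : Fin 2) (t : ℝ) : ℝ :=
  (√l)⁻¹ *
    (if e = 0 then (Set.Ico c (c + l)).indicator 1 t
      else (Set.Ico c (c + l / 2)).indicator 1 t - (Set.Ico (c + l / 2) (c + l)).indicator 1 t)

/-- The Haar function `h_I^η`, `η ∈ {0,1}^d`, of the cube `I = I_1 × ⋯ × I_d`. -/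
noncomputable def haar {d : ℕ} (ω : ℤ → Fin d → Fin 2) (I : DyadicCube d) (η : Fin d → Fin 2)
    (x : Fin d → ℝ) : ℝ :=
  ∏ r, haar1 (I.corner ω r) I.sideLength (η r) (x r)

/-- A family of coefficients `a_{IJK}^{ηθ}`, with the arguments in the order `I J K η θ`. -/
abbrev Coefficients (d : ℕ) : Type :=
  DyadicCube d → DyadicCube d → DyadicCube d → (Fin d → Fin 2) → (Fin d → Fin 2) → ℂ

/-- The averaging operator
`A_K f = ∑_{I,J} ∑_{η,θ} a_{IJK}^{ηθ} ⟨f, h_I^η⟩ h_J^θ`, where `I, J ⊆ K`,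
`ℓ(I) = 2^(-i) ℓ(K)`, `ℓ(J) = 2^(-j) ℓ(K)`, and `⟨f, h⟩ = ∫ f h`. -/
noncomputable def avgOp {d : ℕ} (ω : ℤ → Fin d → Fin 2) (i j : ℕ) (a : Coefficients d)
    (K : DyadicCube d) (f : (Fin d → ℝ) → ℂ) (x : Fin d → ℝ) : ℂ :=
  ∑ I ∈ descendants ω i K, ∑ J ∈ descendants ω j K, ∑ η : Fin d → Fin 2, ∑ θ : Fin d → Fin 2,
    a I J K η θ * (∫ y, f y * (haar ω I η y : ℂ)) * (haar ω J θ x : ℂ)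

/-- The series `∑_{K ∈ 𝒬} u_K` converges unconditionally to `g` in `L²(μ)`. -/
def HasL2Sum {d : ℕ} (μ : Measure (Fin d → ℝ)) (𝒬 : Set (DyadicCube d))
    (u : DyadicCube d → (Fin d → ℝ) → ℂ) (g : (Fin d → ℝ) → ℂ) : Prop :=
  (∀ K ∈ 𝒬, MemLp (u K) 2 μ) ∧ MemLp g 2 μ ∧
    Tendsto (fun F : Finset 𝒬 => eLpNorm (fun x => g x - ∑ K ∈ F, u K x) 2 μ) atTop (𝓝 0)

/-- The coefficients `a` define a dyadic shift `S = ∑_K A_K` with parameters `(i, j)` on `𝒟^ω`: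
the coefficients satisfy the size condition, and every subshift `S_𝒬 = ∑_{K ∈ 𝒬} A_K` maps
`L²(ℝ^d)` to `L²(ℝ^d)` with norm at most one. -/
structure IsDyadicShift {d : ℕ} (ω : ℤ → Fin d → Fin 2) (i j : ℕ) (a : Coefficients d) :
    Prop where
  coeff_le : ∀ K, ∀ I ∈ descendants ω i K, ∀ J ∈ descendants ω j K, ∀ η θ,
    ‖a I J K η θ‖ ≤
      √(volume.real (I.toSet ω) * volume.real (J.toSet ω)) / volume.real (K.toSet ω)
  subshift_le : ∀ (𝒬 : Set (DyadicCube d)) (f : (Fin d → ℝ) → ℂ), MemLp f 2 volume →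
    ∃ g, HasL2Sum volume 𝒬 (fun K => avgOp ω i j a K f) g ∧
      eLpNorm g 2 volume ≤ eLpNorm f 2 volume

/-- A weight: a nonnegative locally integrable function on `ℝ^d`. -/
structure IsWeight {d : ℕ} (w : (Fin d → ℝ) → ℝ) : Prop where
  nonneg : ∀ x, 0 ≤ w x
  locallyIntegrable : LocallyIntegrable w volume

/-- The measure `w(x) dx`. -/
noncomputable def weightMeasure {d : ℕ} (w : (Fin d → ℝ) → ℝ) : Measure (Fin d → ℝ) :=
  volume.withDensity (fun x => ENNReal.ofReal (w x))

/-- The joint characteristic `[w, σ]_{A_2} = sup_Q w(Q) σ(Q) / |Q|²`, over `Q ∈ 𝒟^ω`. -/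
noncomputable def jointA2 {d : ℕ} (ω : ℤ → Fin d → Fin 2) (w σ : (Fin d → ℝ) → ℝ) : ℝ≥0∞ :=
  ⨆ Q : DyadicCube d,
    weightMeasure w (Q.toSet ω) * weightMeasure σ (Q.toSet ω) / volume (Q.toSet ω) ^ 2

/-- The dyadic maximal function `M(w 1_Q)(x) = sup_{R ∋ x} |R|⁻¹ ∫_R w 1_Q`, over `R ∈ 𝒟^ω`. -/
noncomputable def dyadicMaximal {d : ℕ} (ω : ℤ → Fin d → Fin 2) (w : (Fin d → ℝ) → ℝ)
    (Q : DyadicCube d) (x : Fin d → ℝ) : ℝ≥0∞ :=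
  ⨆ (R : DyadicCube d) (_ : x ∈ R.toSet ω),
    weightMeasure w (R.toSet ω ∩ Q.toSet ω) / volume (R.toSet ω)

/-- The characteristic `[w]_{A_∞} = sup_Q w(Q)⁻¹ ∫_Q M(w 1_Q) dx`, over `Q ∈ 𝒟^ω`
(cubes with `w(Q) = 0` contribute `0 / 0 = 0`). -/
noncomputable def charAInfty {d : ℕ} (ω : ℤ → Fin d → Fin 2) (w : (Fin d → ℝ) → ℝ) : ℝ≥0∞ :=
  ⨆ Q : DyadicCube d,
    (∫⁻ x in Q.toSet ω, dyadicMaximal ω w Q x) / weightMeasure w (Q.toSet ω)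

end DyadicShift

namespace DyadicShift

variable {d : ℕ} {ω : ℤ → Fin d → Fin 2}

/-! ### Geometry of the dyadic cubes -/

/-! The bound is proved for finite partial sums in dual form. If `G` is a finite sum of `A_K(σf)`,
pairing it with `w` times its conjugate turns the squared norm of `G` in `L²(w)` into the bilinear
form `∑ avgForm` at `φ = σf`, `ψ = w·conj G`. Two estimates control this form.

Sparse domination (`exists_sparse_bound`): the form is at most `C(1+κ) ∑_S |S|⁻¹ ∫_S|φ| ∫_S|ψ|` over
a sparse family. No weak type bound for the shift is needed. On a cube `Q₀` where the relevant
averages of `φ` and `ψ` stay below `s` and `t`, both functions are replaced by their averages over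
the maximal cubes that contain no cube of `𝒬`. The replaced functions are bounded, so the unweighted
`L²` bound of the subshift applies. The error is made of mean zero pieces on cubes `P`, and such a
piece is seen only by cubes `K` within `i` (or `j`) generations above `P`, which produces the factor
`κ` (`norm_sum_avgForm_local`). Stopping when an average more than quadruples organizes these local
estimates.

Two-weight bound for sparse forms (`sum_sparse_le`): principal cubes for the weighted averages of
`|f|` and `|G|` split the sum into two symmetric halves. Each half reduces to a testing estimate on
a corona, where joint `A_2` controls the square of the sparse operator and `A_∞` gives the packing
of the weight over a sparse family (`integral_sq_sum_indicator_le`, `sum_le_charAInfty`). A Carleson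
embedding then sums the coronas.

Finally, uniformly bounded finite partial sums in a Hilbert space force unconditional convergence
(`summable_of_norm_sum_le`), and the limit inherits the bound. -/

lemma offset_eq (ω : ℤ → Fin d → Fin 2) (k : ℤ) (r : Fin d) :
    offset ω k r = (2 : ℝ) ^ (-(k + 1)) * ((ω (k + 1) r : ℕ) : ℝ) + offset ω (k + 1) r := by
  have hs : Summable fun n : ℕ =>
      (2 : ℝ) ^ (-(k + 1 + (n : ℤ))) * ((ω (k + 1 + (n : ℤ)) r : ℕ) : ℝ) := by
    have hg : Summable fun n : ℕ => (2 : ℝ) ^ (-(k + 1)) * (1 / 2 : ℝ) ^ n :=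
      summable_geometric_two.mul_left _
    refine Summable.of_nonneg_of_le (fun n => by positivity) (fun n => ?_) hg
    have h1 : ((ω (k + 1 + (n : ℤ)) r : ℕ) : ℝ) ≤ 1 := by
      exact_mod_cast Nat.lt_succ_iff.mp (ω (k + 1 + (n : ℤ)) r).isLt
    have h2 : (2 : ℝ) ^ (-(k + 1 + (n : ℤ))) = (2 : ℝ) ^ (-(k + 1)) * (1 / 2 : ℝ) ^ n := by
      rw [neg_add, zpow_add₀ two_ne_zero, zpow_neg _ (n : ℤ), zpow_natCast]
      simp
    rw [h2]
    exact mul_le_of_le_one_right (by positivity) h1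
  unfold offset
  rw [hs.tsum_eq_zero_add]
  congr 1
  · simp
  · refine tsum_congr fun n => ?_
    have : k + 1 + ((n + 1 : ℕ) : ℤ) = k + 1 + 1 + (n : ℤ) := by push_cast; ring
    rw [this]

/-- The cube of generation `k` that contains `x`. -/
noncomputable def cubeAt (ω : ℤ → Fin d → Fin 2) (k : ℤ) (x : Fin d → ℝ) : DyadicCube d :=
  ⟨k, fun r => ⌊(x r - offset ω k r) / (2 : ℝ) ^ (-k)⌋⟩

@[simp] lemma cubeAt_scale (k : ℤ) (x : Fin d → ℝ) : (cubeAt ω k x).scale = k := rfl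

lemma mem_toSet_iff {Q : DyadicCube d} {x : Fin d → ℝ} :
    x ∈ Q.toSet ω ↔ cubeAt ω Q.scale x = Q := by
  obtain ⟨k, m⟩ := Q
  have hl : (0 : ℝ) < (2 : ℝ) ^ (-k) := by positivity
  simp only [DyadicCube.toSet, DyadicCube.corner, DyadicCube.sideLength, Set.mem_ofPred_eq, cubeAt,
    DyadicCube.mk.injEq, true_and, funext_iff, Int.floor_eq_iff]
  refine forall_congr' fun r => and_congr ?_ ?_
  · rw [le_div_iff₀ hl]; constructor <;> intro h <;> linarith
  · rw [div_lt_iff₀ hl]; constructor <;> intro h <;> linarith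

lemma mem_cubeAt (k : ℤ) (x : Fin d → ℝ) : x ∈ (cubeAt ω k x).toSet ω :=
  mem_toSet_iff.mpr rfl

lemma eq_of_mem_of_scale_eq {Q R : DyadicCube d} {x : Fin d → ℝ} (hQ : x ∈ Q.toSet ω)
    (hR : x ∈ R.toSet ω) (h : Q.scale = R.scale) : Q = R := by
  rw [mem_toSet_iff] at hQ hR
  rw [← hQ, ← hR, h]

/-- The offsets of consecutive generations differ by one binary digit, so the coarse index is the
fine index minus that digit, floor-divided by two. This is the source of all nestedness of the
grids. -/
lemma floor_coarsen {k : ℤ} {r : Fin d} {s t : ℝ}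
    (h : ⌊(s - offset ω (k + 1) r) / (2 : ℝ) ^ (-(k + 1))⌋ =
      ⌊(t - offset ω (k + 1) r) / (2 : ℝ) ^ (-(k + 1))⌋) :
    ⌊(s - offset ω k r) / (2 : ℝ) ^ (-k)⌋ = ⌊(t - offset ω k r) / (2 : ℝ) ^ (-k)⌋ := by
  have key : ∀ u : ℝ, ⌊(u - offset ω k r) / (2 : ℝ) ^ (-k)⌋ =
      (⌊(u - offset ω (k + 1) r) / (2 : ℝ) ^ (-(k + 1))⌋ - ((ω (k + 1) r : ℕ) : ℤ)) / 2 := by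
    intro u
    have hh : (2 : ℝ) ^ (-k) = 2 * (2 : ℝ) ^ (-(k + 1)) := by
      rw [neg_add, zpow_add₀ two_ne_zero, zpow_neg_one]; ring
    have hpos : (0 : ℝ) < (2 : ℝ) ^ (-(k + 1)) := by positivity
    rw [offset_eq, hh]
    set l := (2 : ℝ) ^ (-(k + 1))
    have : (u - (l * ((ω (k + 1) r : ℕ) : ℝ) + offset ω (k + 1) r)) / (2 * l) =
        ((u - offset ω (k + 1) r) / l - ((ω (k + 1) r : ℕ) : ℤ)) / (2 : ℕ) := by
      push_cast; field_simp; ring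
    rw [this, Int.floor_div_natCast, Int.floor_sub_intCast]
    rfl
  rw [key, key, h]

lemma cubeAt_coarsen {k l : ℤ} (hkl : k ≤ l) {x y : Fin d → ℝ}
    (h : cubeAt ω l x = cubeAt ω l y) : cubeAt ω k x = cubeAt ω k y := by
  obtain ⟨n, rfl⟩ := Int.le.dest hkl
  induction n with
  | zero => simpa using h
  | succ n ih =>
    refine ih (by omega) ?_
    simp only [cubeAt, DyadicCube.mk.injEq, true_and, funext_iff] at h ⊢
    intro r
    refine floor_coarsen ?_
    have := h r
    push_cast at this
    rw [← add_assoc] at this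
    exact this

/-- Two dyadic cubes that meet are nested. -/
lemma subset_of_mem {Q R : DyadicCube d} {x : Fin d → ℝ} (hQ : x ∈ Q.toSet ω)
    (hR : x ∈ R.toSet ω) (h : Q.scale ≤ R.scale) : R.toSet ω ⊆ Q.toSet ω := by
  intro y hy
  rw [mem_toSet_iff] at *
  rw [← hQ]
  exact cubeAt_coarsen h (hy.trans hR.symm)

lemma subset_or_subset {Q R : DyadicCube d} {x : Fin d → ℝ} (hQ : x ∈ Q.toSet ω)
    (hR : x ∈ R.toSet ω) : R.toSet ω ⊆ Q.toSet ω ∨ Q.toSet ω ⊆ R.toSet ω :=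
  (le_total Q.scale R.scale).imp (subset_of_mem hQ hR) (subset_of_mem hR hQ)

lemma subset_or_subset_of_subset {P Q R : DyadicCube d} (hQ : P.toSet ω ⊆ Q.toSet ω)
    (hR : P.toSet ω ⊆ R.toSet ω) : R.toSet ω ⊆ Q.toSet ω ∨ Q.toSet ω ⊆ R.toSet ω :=
  subset_or_subset (hQ (P.corner_mem ω)) (hR (P.corner_mem ω))

lemma toSet_eq_pi (Q : DyadicCube d) :
    Q.toSet ω = Set.pi Set.univ
      fun r => Set.Ico (Q.corner ω r) (Q.corner ω r + Q.sideLength) := by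
  ext x; simp [DyadicCube.toSet, Set.mem_pi]

lemma measurableSet_toSet (Q : DyadicCube d) : MeasurableSet (Q.toSet ω) := by
  rw [toSet_eq_pi]
  exact MeasurableSet.univ_pi fun r => measurableSet_Ico

lemma volume_toSet (Q : DyadicCube d) :
    volume (Q.toSet ω) = ENNReal.ofReal (Q.sideLength ^ d) := by
  rw [toSet_eq_pi, Real.volume_pi_Ico]
  simp [ENNReal.ofReal_pow Q.sideLength_pos.le]

lemma volume_real_toSet (Q : DyadicCube d) : volume.real (Q.toSet ω) = Q.sideLength ^ d := by
  rw [measureReal_def, volume_toSet, ENNReal.toReal_ofReal (pow_nonneg Q.sideLength_pos.le _)]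

lemma volume_real_pos (Q : DyadicCube d) : 0 < volume.real (Q.toSet ω) := by
  rw [volume_real_toSet]; exact pow_pos Q.sideLength_pos _

lemma volume_ne_top (Q : DyadicCube d) : volume (Q.toSet ω) ≠ ∞ := by
  rw [volume_toSet]; exact ENNReal.ofReal_ne_top

lemma volume_ne_zero (Q : DyadicCube d) : volume (Q.toSet ω) ≠ 0 := by
  rw [volume_toSet]; simpa using pow_pos Q.sideLength_pos d

/-- Volumes are compared, which needs `d ≠ 0`: in dimension zero every cube is the same one-point
set and the set does not determine the scale. -/
lemma scale_le_of_subset [NeZero d] {Q R : DyadicCube d} (h : R.toSet ω ⊆ Q.toSet ω) :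
    Q.scale ≤ R.scale := by
  by_contra hlt
  push Not at hlt
  have h1 : volume.real (R.toSet ω) ≤ volume.real (Q.toSet ω) :=
    measureReal_mono h (volume_ne_top Q)
  rw [volume_real_toSet, volume_real_toSet,
    pow_le_pow_iff_left₀ R.sideLength_pos.le Q.sideLength_pos.le (NeZero.ne d)] at h1
  have h2 : Q.sideLength < R.sideLength :=
    zpow_lt_zpow_right₀ one_lt_two (by omega)
  linarith

lemma eq_of_toSet_eq [NeZero d] {Q R : DyadicCube d} (h : R.toSet ω = Q.toSet ω) : R = Q :=
  eq_of_mem_of_scale_eq (R.corner_mem ω) (h ▸ R.corner_mem ω)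
    (le_antisymm (scale_le_of_subset h.ge) (scale_le_of_subset h.le))

lemma eq_of_subset_of_subset [NeZero d] {Q R : DyadicCube d} (h : R.toSet ω ⊆ Q.toSet ω)
    (h' : Q.toSet ω ⊆ R.toSet ω) : R = Q :=
  eq_of_toSet_eq (h.antisymm h')

lemma scale_lt_of_subset_of_ne [NeZero d] {Q R : DyadicCube d} (h : R.toSet ω ⊆ Q.toSet ω)
    (hne : R ≠ Q) : Q.scale < R.scale :=
  lt_of_le_of_ne (scale_le_of_subset h) fun he =>
    hne (eq_of_mem_of_scale_eq (R.corner_mem ω) (h (R.corner_mem ω)) he.symm)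

/-- The dyadic parent of a cube. -/
noncomputable def parent (ω : ℤ → Fin d → Fin 2) (Q : DyadicCube d) : DyadicCube d :=
  cubeAt ω (Q.scale - 1) (Q.corner ω)

lemma parent_scale (Q : DyadicCube d) : (parent ω Q).scale = Q.scale - 1 := rfl

lemma subset_parent (Q : DyadicCube d) : Q.toSet ω ⊆ (parent ω Q).toSet ω :=
  subset_of_mem (mem_cubeAt _ _) (Q.corner_mem ω) (by rw [parent_scale]; omega)

lemma parent_subset [NeZero d] {Q R : DyadicCube d} (h : R.toSet ω ⊆ Q.toSet ω)
    (hne : R ≠ Q) : (parent ω R).toSet ω ⊆ Q.toSet ω :=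
  subset_of_mem (h (R.corner_mem ω)) (mem_cubeAt _ _)
    (by have := scale_lt_of_subset_of_ne h hne; rw [parent_scale]; omega)

lemma volume_real_parent (Q : DyadicCube d) :
    volume.real ((parent ω Q).toSet ω) = 2 ^ d * volume.real (Q.toSet ω) := by
  rw [volume_real_toSet, volume_real_toSet, ← mul_pow]
  congr 1
  unfold DyadicCube.sideLength
  rw [parent_scale, neg_sub, sub_eq_add_neg, zpow_add₀ two_ne_zero, zpow_one]

lemma mem_descendants {i : ℕ} {K I : DyadicCube d} :
    I ∈ descendants ω i K ↔ I.scale = K.scale + i ∧ I.toSet ω ⊆ K.toSet ω := by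
  simp [descendants]

lemma finite_between [NeZero d] (Q : DyadicCube d) (N : ℤ) :
    {R : DyadicCube d | R.toSet ω ⊆ Q.toSet ω ∧ R.scale ≤ N}.Finite := by
  refine Set.Finite.subset ((Finset.range ((N - Q.scale).toNat + 1)).finite_toSet.biUnion
    fun n _ => finite_descendants ω n Q) ?_
  rintro R ⟨hR, hN⟩
  have := scale_le_of_subset hR
  simp only [Set.mem_iUnion]
  refine ⟨(R.scale - Q.scale).toNat, ?_, ?_, hR⟩
  · simp; omega
  · omega

/-! ### Haar functions -/

lemma norm_haar1_le (c l : ℝ) (hl : 0 < l) (e : Fin 2) (t : ℝ) :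
    |haar1 c l e t| ≤ (√l)⁻¹ * (Set.Ico c (c + l)).indicator 1 t := by
  unfold haar1
  rw [abs_mul, abs_of_nonneg (by positivity : 0 ≤ (√l)⁻¹)]
  refine mul_le_mul_of_nonneg_left ?_ (by positivity)
  simp only [Set.indicator_apply, Set.mem_Ico, Pi.one_apply]
  by_cases h0 : c ≤ t <;> by_cases h1 : t < c + l <;> by_cases h2 : t < c + l / 2 <;>
    by_cases h3 : c + l / 2 ≤ t <;> by_cases h4 : e = 0 <;>
    simp only [h0, h1, h2, h3, h4, and_true, and_false, and_self, if_true, if_false] <;>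
    first | (exfalso; linarith) | norm_num

lemma haar_eq_zero {I : DyadicCube d} {η : Fin d → Fin 2} {x : Fin d → ℝ}
    (hx : x ∉ I.toSet ω) : haar ω I η x = 0 := by
  simp only [DyadicCube.toSet, Set.mem_ofPred_eq, not_forall] at hx
  obtain ⟨r, hr⟩ := hx
  refine Finset.prod_eq_zero (Finset.mem_univ r) ?_
  have := norm_haar1_le (I.corner ω r) I.sideLength I.sideLength_pos (η r) (x r)
  rw [Set.indicator_of_notMem (by simpa [Set.mem_Ico] using hr), mul_zero] at this
  exact abs_eq_zero.mp (le_antisymm this (abs_nonneg _))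

lemma abs_haar_le (I : DyadicCube d) (η : Fin d → Fin 2) (x : Fin d → ℝ) :
    |haar ω I η x| ≤ (√(volume.real (I.toSet ω)))⁻¹ := by
  unfold haar
  rw [Finset.abs_prod, volume_real_toSet]
  have : (√(I.sideLength ^ d))⁻¹ = ∏ _r : Fin d, (√I.sideLength)⁻¹ := by
    rw [Finset.prod_const, Finset.card_univ, Fintype.card_fin, inv_pow]
    congr 1
    rw [Real.sqrt_eq_iff_mul_self_eq (pow_nonneg I.sideLength_pos.le _) (by positivity), ← mul_pow,
      Real.mul_self_sqrt I.sideLength_pos.le]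
  rw [this]
  refine Finset.prod_le_prod (fun _ _ => abs_nonneg _) fun r _ => ?_
  refine (norm_haar1_le _ _ I.sideLength_pos _ _).trans ?_
  refine mul_le_of_le_one_right (by positivity) ?_
  exact Set.indicator_le_self' (fun _ _ => zero_le_one) _

lemma measurable_haar (I : DyadicCube d) (η : Fin d → Fin 2) : Measurable (haar ω I η) := by
  unfold haar
  refine Finset.measurable_prod _ fun r _ => ?_
  have : Measurable (haar1 (I.corner ω r) I.sideLength (η r)) := by
    unfold haar1
    refine Measurable.const_mul ?_ _
    split_ifs
    · exact measurable_one.indicator measurableSet_Ico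
    · exact (measurable_one.indicator measurableSet_Ico).sub
        (measurable_one.indicator measurableSet_Ico)
  exact this.comp (measurable_pi_apply r)

lemma mem_Ico_iff_floor {h s : ℝ} (hh : 0 < h) (a b : ℤ) :
    s ∈ Set.Ico (a * h) (b * h) ↔ a ≤ ⌊s / h⌋ ∧ ⌊s / h⌋ < b := by
  rw [Set.mem_Ico, Int.le_floor, Int.floor_lt, le_div_iff₀ hh, div_lt_iff₀ hh]

/-- A Haar function of `I` is constant on the cubes that are smaller than `I`. -/
lemma haar_eq_of_mem {I P : DyadicCube d} (η : Fin d → Fin 2) (h : I.scale + 1 ≤ P.scale)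
    {x y : Fin d → ℝ} (hx : x ∈ P.toSet ω) (hy : y ∈ P.toSet ω) :
    haar ω I η x = haar ω I η y := by
  have hxy : cubeAt ω (I.scale + 1) x = cubeAt ω (I.scale + 1) y :=
    cubeAt_coarsen h ((mem_toSet_iff.mp hx).trans (mem_toSet_iff.mp hy).symm)
  simp only [cubeAt, DyadicCube.mk.injEq, true_and, funext_iff] at hxy
  refine Finset.prod_congr rfl fun r _ => ?_
  have hf := hxy r
  set l := (2 : ℝ) ^ (-(I.scale + 1)) with hl
  have hl0 : 0 < l := by positivity
  have hside : I.sideLength = 2 * l := by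
    rw [hl, neg_add, zpow_add₀ two_ne_zero, zpow_neg_one, DyadicCube.sideLength]; ring
  -- `m` is the index of the left half of `I_r` in the grid of generation `I.scale + 1`. The
  -- intervals in `haar1` are unions of cells of that grid, so membership depends only on the floor,
  -- which `x` and `y` share.
  set m : ℤ := 2 * I.index r + ((ω (I.scale + 1) r : ℕ) : ℤ) with hm
  have hc : I.corner ω r = m * l + offset ω (I.scale + 1) r := by
    unfold DyadicCube.corner
    rw [offset_eq, hside, hm, ← hl]; push_cast; ring
  have key : ∀ (p q : ℤ) (t : ℝ), t ∈ Set.Ico (I.corner ω r + p * l) (I.corner ω r + q * l) ↔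
      m + p ≤ ⌊(t - offset ω (I.scale + 1) r) / l⌋ ∧
        ⌊(t - offset ω (I.scale + 1) r) / l⌋ < m + q := by
    intro p q t
    rw [← mem_Ico_iff_floor hl0, hc]
    simp only [Set.mem_Ico]
    push_cast
    refine and_congr ?_ ?_ <;> constructor <;> intro h <;> linarith
  have key' : ∀ p q : ℤ, x r ∈ Set.Ico (I.corner ω r + p * l) (I.corner ω r + q * l) ↔
      y r ∈ Set.Ico (I.corner ω r + p * l) (I.corner ω r + q * l) := by
    intro p q; rw [key, key, hf]
  have k1 := key' 0 2
  have k2 := key' 0 1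
  have k3 := key' 1 2
  simp only [Int.cast_zero, zero_mul, add_zero, Int.cast_one, one_mul, Int.cast_ofNat] at k1 k2 k3
  have hhalf : I.sideLength / 2 = l := by rw [hside]; ring
  unfold haar1
  rw [hhalf, hside]
  simp only [Set.indicator_apply, k1, k2, k3, Pi.one_apply]

/-! ### The bilinear forms of the averaging operators -/

/-- Integrability on all dyadic cubes. -/
def IntegrableOnCubes (ω : ℤ → Fin d → Fin 2) (φ : (Fin d → ℝ) → ℂ) : Prop :=
  ∀ Q : DyadicCube d, IntegrableOn φ (Q.toSet ω)

/-- The size condition on the coefficients of a dyadic shift. -/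
def SizeCondition (ω : ℤ → Fin d → Fin 2) (i j : ℕ) (a : Coefficients d) : Prop :=
  ∀ K, ∀ I ∈ descendants ω i K, ∀ J ∈ descendants ω j K, ∀ η θ, ‖a I J K η θ‖ ≤
    √(volume.real (I.toSet ω) * volume.real (J.toSet ω)) / volume.real (K.toSet ω)

/-- The Haar coefficient `⟨φ, h_I^η⟩`. -/
noncomputable def haarCoeff (ω : ℤ → Fin d → Fin 2) (φ : (Fin d → ℝ) → ℂ) (I : DyadicCube d)
    (η : Fin d → Fin 2) : ℂ :=
  ∫ y, φ y * (haar ω I η y : ℂ)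

/-- The bilinear form `∫ (A_K φ) ψ`. -/
noncomputable def avgForm (ω : ℤ → Fin d → Fin 2) (i j : ℕ) (a : Coefficients d)
    (K : DyadicCube d) (φ ψ : (Fin d → ℝ) → ℂ) : ℂ :=
  ∑ I ∈ descendants ω i K, ∑ J ∈ descendants ω j K, ∑ η : Fin d → Fin 2, ∑ θ : Fin d → Fin 2,
    a I J K η θ * haarCoeff ω φ I η * haarCoeff ω ψ J θ

/-- The coefficients of the transposed shift. -/
def transposeCoeff (a : Coefficients d) : Coefficients d := fun I J K η θ => a J I K θ η

lemma SizeCondition.transpose {i j : ℕ} {a : Coefficients d} (h : SizeCondition ω i j a) :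
    SizeCondition ω j i (transposeCoeff a) := fun K I hI J hJ η θ => by
  rw [mul_comm]; exact h K J hJ I hI θ η

lemma avgForm_transpose (i j : ℕ) (a : Coefficients d) (K : DyadicCube d)
    (φ ψ : (Fin d → ℝ) → ℂ) :
    avgForm ω j i (transposeCoeff a) K ψ φ = avgForm ω i j a K φ ψ := by
  unfold avgForm
  rw [Finset.sum_comm]
  refine Finset.sum_congr rfl fun I _ => Finset.sum_congr rfl fun J _ => ?_
  rw [Finset.sum_comm]
  refine Finset.sum_congr rfl fun η _ => Finset.sum_congr rfl fun θ _ => ?_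
  simp only [transposeCoeff]; ring

lemma mul_haar_eq_indicator (φ : (Fin d → ℝ) → ℂ) (I : DyadicCube d) (η : Fin d → Fin 2) :
    (fun y => φ y * (haar ω I η y : ℂ)) =
      (I.toSet ω).indicator fun y => φ y * (haar ω I η y : ℂ) := by
  ext y
  by_cases hy : y ∈ I.toSet ω
  · simp [hy]
  · simp [hy, haar_eq_zero hy]

lemma IntegrableOnCubes.integrable_mul_haar {φ : (Fin d → ℝ) → ℂ} (hφ : IntegrableOnCubes ω φ)
    (I : DyadicCube d) (η : Fin d → Fin 2) :
    Integrable fun y => φ y * (haar ω I η y : ℂ) := by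
  rw [mul_haar_eq_indicator, integrable_indicator_iff (measurableSet_toSet I)]
  refine Integrable.mul_bdd (c := (√(volume.real (I.toSet ω)))⁻¹) (hφ I)
    (Complex.measurable_ofReal.comp (measurable_haar I η)).aestronglyMeasurable ?_
  filter_upwards with y
  simpa using abs_haar_le I η y

lemma norm_haarCoeff_le {φ : (Fin d → ℝ) → ℂ} (hφ : IntegrableOnCubes ω φ) (I : DyadicCube d)
    (η : Fin d → Fin 2) :
    ‖haarCoeff ω φ I η‖ ≤ (√(volume.real (I.toSet ω)))⁻¹ * ∫ y in I.toSet ω, ‖φ y‖ := by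
  unfold haarCoeff
  rw [mul_haar_eq_indicator, integral_indicator (measurableSet_toSet I), ← integral_const_mul]
  refine norm_integral_le_of_norm_le ((hφ I).norm.const_mul _) ?_
  filter_upwards with y
  rw [norm_mul, mul_comm]
  gcongr
  simpa using abs_haar_le I η y

lemma haarCoeff_sub {φ φ' : (Fin d → ℝ) → ℂ} (hφ : IntegrableOnCubes ω φ)
    (hφ' : IntegrableOnCubes ω φ') (I : DyadicCube d) (η : Fin d → Fin 2) :
    haarCoeff ω (fun x => φ x - φ' x) I η = haarCoeff ω φ I η - haarCoeff ω φ' I η := by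
  unfold haarCoeff
  rw [← integral_sub (hφ.integrable_mul_haar I η) (hφ'.integrable_mul_haar I η)]
  simp only [sub_mul]

lemma haarCoeff_sum {ι : Type*} {s : Finset ι} {φ : ι → (Fin d → ℝ) → ℂ}
    (hφ : ∀ P ∈ s, IntegrableOnCubes ω (φ P)) (I : DyadicCube d) (η : Fin d → Fin 2) :
    haarCoeff ω (fun x => ∑ P ∈ s, φ P x) I η = ∑ P ∈ s, haarCoeff ω (φ P) I η := by
  unfold haarCoeff
  rw [← integral_finsetSum _ fun P hP => (hφ P hP).integrable_mul_haar I η]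
  simp only [Finset.sum_mul]

lemma haarCoeff_congr {φ φ' : (Fin d → ℝ) → ℂ} {I : DyadicCube d}
    (h : ∀ x ∈ I.toSet ω, φ x = φ' x) (η : Fin d → Fin 2) :
    haarCoeff ω φ I η = haarCoeff ω φ' I η := by
  unfold haarCoeff
  congr 1
  ext y
  by_cases hy : y ∈ I.toSet ω
  · rw [h y hy]
  · simp [haar_eq_zero hy]

lemma sum_setIntegral_le {X ι : Type*} [MeasurableSpace X] {μ : Measure X} {s : Finset ι}
    {A : ι → Set X} {B : Set X} {f : X → ℝ} (hm : ∀ P ∈ s, MeasurableSet (A P))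
    (hd : (s : Set ι).PairwiseDisjoint A) (hsub : ∀ P ∈ s, A P ⊆ B) (hf : ∀ x, 0 ≤ f x)
    (hi : IntegrableOn f B μ) :
    ∑ P ∈ s, ∫ x in A P, f x ∂μ ≤ ∫ x in B, f x ∂μ := by
  rw [← integral_biUnion_finset s hm hd fun P hP => hi.mono_set (hsub P hP)]
  exact setIntegral_mono_set hi (ae_of_all _ hf)
    (LE.le.eventuallyLE (Set.iUnion₂_subset hsub))

lemma pairwiseDisjoint_descendants (i : ℕ) (K : DyadicCube d) :
    (descendants ω i K : Set (DyadicCube d)).PairwiseDisjoint (DyadicCube.toSet ω) := by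
  intro I hI J hJ hne
  rw [Function.onFun, Set.disjoint_left]
  intro x hx hx'
  rw [Finset.mem_coe, mem_descendants] at hI hJ
  exact hne (eq_of_mem_of_scale_eq hx hx' (hI.1.trans hJ.1.symm))

lemma sum_descendants_le {φ : (Fin d → ℝ) → ℂ} (hφ : IntegrableOnCubes ω φ) (i : ℕ)
    (K : DyadicCube d) :
    ∑ I ∈ descendants ω i K, ∫ y in I.toSet ω, ‖φ y‖ ≤ ∫ y in K.toSet ω, ‖φ y‖ :=
  sum_setIntegral_le (fun I _ => measurableSet_toSet I) (pairwiseDisjoint_descendants i K)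
    (fun _ hI => (mem_descendants.mp hI).2) (fun _ => norm_nonneg _) (hφ K).norm

/-- The Haar normalizations cancel `√(|I||J|)` in the size condition, so each of the `4 ^ d` pairs
`(η, θ)` contributes at most `|K|⁻¹ ∫_I|φ| ∫_J|ψ|`. The `I` are disjoint inside `K`, and so are the
`J`. -/
lemma norm_avgForm_le {i j : ℕ} {a : Coefficients d} (ha : SizeCondition ω i j a)
    {φ ψ : (Fin d → ℝ) → ℂ} (hφ : IntegrableOnCubes ω φ) (hψ : IntegrableOnCubes ω ψ)
    (K : DyadicCube d) :
    ‖avgForm ω i j a K φ ψ‖ ≤ 4 ^ d / volume.real (K.toSet ω) *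
      ((∫ x in K.toSet ω, ‖φ x‖) * ∫ x in K.toSet ω, ‖ψ x‖) := by
  have hK := volume_real_pos (ω := ω) K
  have hterm : ∀ I ∈ descendants ω i K, ∀ J ∈ descendants ω j K, ∀ η θ,
      ‖a I J K η θ * haarCoeff ω φ I η * haarCoeff ω ψ J θ‖ ≤
        (volume.real (K.toSet ω))⁻¹ *
          ((∫ x in I.toSet ω, ‖φ x‖) * ∫ x in J.toSet ω, ‖ψ x‖) := by
    intro I hI J hJ η θ
    have hI0 := volume_real_pos (ω := ω) I
    have hJ0 := volume_real_pos (ω := ω) J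
    rw [norm_mul, norm_mul]
    have h1 := ha K I hI J hJ η θ
    have h2 := norm_haarCoeff_le hφ I η
    have h3 := norm_haarCoeff_le hψ J θ
    calc _ ≤ √(volume.real (I.toSet ω) * volume.real (J.toSet ω)) / volume.real (K.toSet ω) *
        ((√(volume.real (I.toSet ω)))⁻¹ * ∫ y in I.toSet ω, ‖φ y‖) *
        ((√(volume.real (J.toSet ω)))⁻¹ * ∫ y in J.toSet ω, ‖ψ y‖) := by gcongr
      _ = _ := by
        rw [Real.sqrt_mul hI0.le]
        have := Real.sqrt_pos.mpr hI0
        have := Real.sqrt_pos.mpr hJ0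
        field_simp
  have hsum : ‖avgForm ω i j a K φ ψ‖ ≤
      ∑ I ∈ descendants ω i K, ∑ J ∈ descendants ω j K, 4 ^ d * ((volume.real (K.toSet ω))⁻¹ *
          ((∫ x in I.toSet ω, ‖φ x‖) * ∫ x in J.toSet ω, ‖ψ x‖)) := by
    refine norm_sum_le_of_le _ fun I hI => norm_sum_le_of_le _ fun J hJ => ?_
    refine (norm_sum_le_of_le _ fun η _ => norm_sum_le_of_le _ fun θ _ =>
      hterm I hI J hJ η θ).trans (le_of_eq ?_)
    simp only [Finset.sum_const, Finset.card_univ, Fintype.card_fun, Fintype.card_fin,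
      nsmul_eq_mul, ← mul_assoc]
    congr 3
    push_cast
    rw [← mul_pow]; norm_num
  refine hsum.trans ?_
  simp only [← Finset.mul_sum, ← Finset.sum_mul]
  rw [← mul_assoc, ← div_eq_mul_inv]
  refine mul_le_mul_of_nonneg_left ?_ (by positivity)
  refine mul_le_mul (sum_descendants_le hφ i K) (sum_descendants_le hψ j K)
    (Finset.sum_nonneg fun _ _ => integral_nonneg fun _ => norm_nonneg _)
    (integral_nonneg fun _ => norm_nonneg _)

lemma avgForm_eq_zero {i j : ℕ} (a : Coefficients d) {φ : (Fin d → ℝ) → ℂ}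
    (ψ : (Fin d → ℝ) → ℂ) {K : DyadicCube d}
    (h : ∀ I ∈ descendants ω i K, ∀ η, haarCoeff ω φ I η = 0) : avgForm ω i j a K φ ψ = 0 := by
  unfold avgForm
  refine Finset.sum_eq_zero fun I hI => Finset.sum_eq_zero fun J _ => Finset.sum_eq_zero
    fun η _ => Finset.sum_eq_zero fun θ _ => ?_
  rw [h I hI η]; ring

lemma avgForm_sub_eq_sum {ι : Type*} {i j : ℕ} (a : Coefficients d)
    {φ φ' : (Fin d → ℝ) → ℂ} (ψ : (Fin d → ℝ) → ℂ) {s : Finset ι} {b : ι → (Fin d → ℝ) → ℂ}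
    (hφ : IntegrableOnCubes ω φ) (hφ' : IntegrableOnCubes ω φ')
    (hb : ∀ P ∈ s, IntegrableOnCubes ω (b P)) {K : DyadicCube d}
    (h : ∀ x ∈ K.toSet ω, φ x - φ' x = ∑ P ∈ s, b P x) :
    avgForm ω i j a K φ ψ - avgForm ω i j a K φ' ψ = ∑ P ∈ s, avgForm ω i j a K (b P) ψ := by
  have hc : ∀ I ∈ descendants ω i K, ∀ η, haarCoeff ω φ I η - haarCoeff ω φ' I η =
      ∑ P ∈ s, haarCoeff ω (b P) I η := by
    intro I hI η
    rw [← haarCoeff_sum hb, ← haarCoeff_sub hφ hφ']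
    exact haarCoeff_congr (fun x hx => h x ((mem_descendants.mp hI).2 hx)) η
  unfold avgForm
  simp only [← Finset.sum_sub_distrib]
  symm
  rw [Finset.sum_comm]
  refine Finset.sum_congr rfl fun I hI => ?_
  rw [Finset.sum_comm]
  refine Finset.sum_congr rfl fun J _ => ?_
  rw [Finset.sum_comm]
  refine Finset.sum_congr rfl fun η _ => ?_
  rw [Finset.sum_comm]
  refine Finset.sum_congr rfl fun θ _ => ?_
  rw [← sub_mul, ← mul_sub, hc I hI η, Finset.mul_sum, Finset.sum_mul]

/-- The average of `φ` over a cube. -/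
noncomputable def cubeAvg (ω : ℤ → Fin d → Fin 2) (φ : (Fin d → ℝ) → ℂ) (P : DyadicCube d) : ℂ :=
  (∫ x in P.toSet ω, φ x) / (volume.real (P.toSet ω) : ℂ)

/-- The function that is equal to the average of `φ` on each cube of `𝒱`. -/
noncomputable def averaged (ω : ℤ → Fin d → Fin 2) (𝒱 : Finset (DyadicCube d))
    (φ : (Fin d → ℝ) → ℂ) (x : Fin d → ℝ) : ℂ :=
  ∑ P ∈ 𝒱, (P.toSet ω).indicator (fun _ => cubeAvg ω φ P) x

/-- The part of `φ` on `P`, with its average subtracted. -/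
noncomputable def oscillation (ω : ℤ → Fin d → Fin 2) (φ : (Fin d → ℝ) → ℂ) (P : DyadicCube d) :
    (Fin d → ℝ) → ℂ :=
  (P.toSet ω).indicator fun x => φ x - cubeAvg ω φ P

lemma norm_cubeAvg_mul_le (φ : (Fin d → ℝ) → ℂ) (P : DyadicCube d) :
    ‖cubeAvg ω φ P‖ * volume.real (P.toSet ω) ≤ ∫ x in P.toSet ω, ‖φ x‖ := by
  have hP := volume_real_pos (ω := ω) P
  unfold cubeAvg
  rw [norm_div, Complex.norm_real, Real.norm_of_nonneg hP.le, div_mul_cancel₀ _ hP.ne']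
  exact norm_integral_le_integral_norm _

lemma integrable_averaged (𝒱 : Finset (DyadicCube d)) (φ : (Fin d → ℝ) → ℂ) :
    Integrable (averaged ω 𝒱 φ) := by
  refine integrable_finsetSum _ fun P _ => ?_
  rw [integrable_indicator_iff (measurableSet_toSet P)]
  exact integrableOn_const (volume_ne_top P)

lemma integrable_oscillation {φ : (Fin d → ℝ) → ℂ} (hφ : IntegrableOnCubes ω φ)
    (P : DyadicCube d) : Integrable (oscillation ω φ P) := by
  unfold oscillation
  rw [integrable_indicator_iff (measurableSet_toSet P)]
  exact (hφ P).sub (integrableOn_const (volume_ne_top P))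

lemma integral_norm_oscillation_le {φ : (Fin d → ℝ) → ℂ} (hφ : IntegrableOnCubes ω φ)
    (P : DyadicCube d) : ∫ x, ‖oscillation ω φ P x‖ ≤ 2 * ∫ x in P.toSet ω, ‖φ x‖ := by
  unfold oscillation
  simp only [norm_indicator_eq_indicator_norm]
  rw [integral_indicator (measurableSet_toSet P)]
  have hc : IntegrableOn (fun _ => ‖cubeAvg ω φ P‖) (P.toSet ω) :=
    integrableOn_const (volume_ne_top P)
  calc ∫ x in P.toSet ω, ‖φ x - cubeAvg ω φ P‖
      ≤ ∫ x in P.toSet ω, (‖φ x‖ + ‖cubeAvg ω φ P‖) :=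
        integral_mono ((hφ P).sub (integrableOn_const (volume_ne_top P))).norm
          ((hφ P).norm.add hc) fun x => norm_sub_le _ _
    _ = (∫ x in P.toSet ω, ‖φ x‖) + ‖cubeAvg ω φ P‖ * volume.real (P.toSet ω) := by
        rw [integral_add (hφ P).norm hc, setIntegral_const, smul_eq_mul, mul_comm]
    _ ≤ _ := by linarith [norm_cubeAvg_mul_le (ω := ω) φ P]

/-- The Haar function of `I` is constant on the smaller cube `P`, where the oscillation has mean
zero. -/
lemma haarCoeff_oscillation {φ : (Fin d → ℝ) → ℂ} (hφ : IntegrableOnCubes ω φ)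
    {P I : DyadicCube d} (h : I.scale + 1 ≤ P.scale) (η : Fin d → Fin 2) :
    haarCoeff ω (oscillation ω φ P) I η = 0 := by
  have hP := volume_real_pos (ω := ω) P
  have : (fun y => oscillation ω φ P y * (haar ω I η y : ℂ)) = fun y =>
      oscillation ω φ P y * (haar ω I η (P.corner ω) : ℂ) := by
    ext y
    by_cases hy : y ∈ P.toSet ω
    · rw [haar_eq_of_mem η h hy (P.corner_mem ω)]
    · simp [oscillation, hy]
  unfold haarCoeff
  rw [this, integral_mul_const]
  unfold oscillation
  rw [integral_indicator (measurableSet_toSet P),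
    integral_sub (hφ P) (integrableOn_const (volume_ne_top P)), setIntegral_const]
  unfold cubeAvg
  rw [Complex.real_smul, mul_div_cancel₀ _ (by exact_mod_cast hP.ne'), sub_self, zero_mul]

lemma haarCoeff_oscillation_of_disjoint (φ : (Fin d → ℝ) → ℂ) {P I : DyadicCube d}
    (h : Disjoint (I.toSet ω) (P.toSet ω)) (η : Fin d → Fin 2) :
    haarCoeff ω (oscillation ω φ P) I η = 0 := by
  rw [haarCoeff_congr (φ' := 0) (fun x hx => ?_)]
  · simp [haarCoeff]
  · simp [oscillation, Set.disjoint_left.mp h hx]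

lemma integrableOnCubes_of_integrable {φ : (Fin d → ℝ) → ℂ} (h : Integrable φ) :
    IntegrableOnCubes ω φ := fun _ => h.integrableOn

lemma sub_averaged {𝒱 : Finset (DyadicCube d)}
    (hdisj : (𝒱 : Set (DyadicCube d)).PairwiseDisjoint (DyadicCube.toSet ω))
    (φ : (Fin d → ℝ) → ℂ) {x : Fin d → ℝ} (hx : ∃ P ∈ 𝒱, x ∈ P.toSet ω) :
    φ x - averaged ω 𝒱 φ x = ∑ P ∈ 𝒱, oscillation ω φ P x := by
  obtain ⟨P, hP, hxP⟩ := hx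
  have hout : ∀ R ∈ 𝒱, R ≠ P → x ∉ R.toSet ω := fun R hR hne hxR =>
    Set.disjoint_left.mp (hdisj hR hP hne) hxR hxP
  unfold averaged
  rw [Finset.sum_eq_single_of_mem P hP fun R hR hne => by simp [hout R hR hne],
    Finset.sum_eq_single_of_mem P hP fun R hR hne => by simp [oscillation, hout R hR hne]]
  simp [oscillation, hxP]

/-- Replacing `φ` by its averages over a family of disjoint cubes that are small with respect to
the cubes of `𝒬`. -/
lemma norm_sum_avgForm_sub_le {i j : ℕ} {a : Coefficients d} (ha : SizeCondition ω i j a)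
    {φ ψ : (Fin d → ℝ) → ℂ} (hφ : IntegrableOnCubes ω φ) (hψ : IntegrableOnCubes ω ψ)
    {𝒬 𝒱 : Finset (DyadicCube d)}
    (hdisj : (𝒱 : Set (DyadicCube d)).PairwiseDisjoint (DyadicCube.toSet ω))
    (hcov : ∀ K ∈ 𝒬, ∀ x ∈ K.toSet ω, ∃ P ∈ 𝒱, x ∈ P.toSet ω)
    (hlt : ∀ K ∈ 𝒬, ∀ P ∈ 𝒱, ∀ x ∈ K.toSet ω, x ∈ P.toSet ω → K.scale < P.scale)
    {b : ℝ} (hb0 : 0 ≤ b)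
    (hb : ∀ K ∈ 𝒬, ∫ x in K.toSet ω, ‖ψ x‖ ≤ b * volume.real (K.toSet ω)) :
    ‖∑ K ∈ 𝒬, avgForm ω i j a K φ ψ - ∑ K ∈ 𝒬, avgForm ω i j a K (averaged ω 𝒱 φ) ψ‖ ≤
      2 * 4 ^ d * i * b * ∑ P ∈ 𝒱, ∫ x in P.toSet ω, ‖φ x‖ := by
  classical
  rw [← Finset.sum_sub_distrib]
  have h1 : ∀ K ∈ 𝒬, avgForm ω i j a K φ ψ - avgForm ω i j a K (averaged ω 𝒱 φ) ψ =
      ∑ P ∈ 𝒱, avgForm ω i j a K (oscillation ω φ P) ψ := fun K hK =>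
    avgForm_sub_eq_sum a ψ hφ (integrableOnCubes_of_integrable (integrable_averaged 𝒱 φ))
      (fun P _ => integrableOnCubes_of_integrable (integrable_oscillation hφ P))
      fun x hx => sub_averaged hdisj φ (hcov K hK x hx)
  rw [Finset.sum_congr rfl h1, Finset.sum_comm, Finset.mul_sum]
  refine norm_sum_le_of_le _ fun P hP => ?_
  -- Only these `K` see the oscillation on `P`: if `P.scale > K.scale + i`, the Haar functions of
  -- the descendants `I` of `K` are constant on `P`.
  set 𝒯 := 𝒬.filter fun K => P.toSet ω ⊆ K.toSet ω ∧ P.scale ≤ K.scale + i ∧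
    K.scale < P.scale with h𝒯
  have hzero : ∀ K ∈ 𝒬, K ∉ 𝒯 → avgForm ω i j a K (oscillation ω φ P) ψ = 0 := by
    intro K hK hKT
    refine avgForm_eq_zero a ψ fun I hI η => ?_
    rw [mem_descendants] at hI
    by_cases hdis : Disjoint (K.toSet ω) (P.toSet ω)
    · exact haarCoeff_oscillation_of_disjoint φ (hdis.mono_left hI.2) η
    · obtain ⟨x, hxK, hxP⟩ := Set.not_disjoint_iff.mp hdis
      have hKP := hlt K hK P hP x hxK hxP
      refine haarCoeff_oscillation hφ ?_ η
      by_contra hcon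
      exact hKT (Finset.mem_filter.mpr
        ⟨hK, subset_of_mem hxK hxP hKP.le, by omega, hKP⟩)
  have hsub : ∑ K ∈ 𝒬, avgForm ω i j a K (oscillation ω φ P) ψ =
      ∑ K ∈ 𝒯, avgForm ω i j a K (oscillation ω φ P) ψ :=
    (Finset.sum_subset (Finset.filter_subset _ _) hzero).symm
  -- The cubes of `𝒯` all contain `P`, so there is at most one for each of the `i` scales from
  -- `P.scale - i` to `P.scale - 1`.
  have hcard : 𝒯.card ≤ i := by
    have : 𝒯.card ≤ (Finset.Ico (P.scale - i) P.scale).card := by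
      refine Finset.card_le_card_of_injOn (fun K => K.scale) ?_ ?_
      · intro K hK
        rw [Finset.mem_coe, h𝒯, Finset.mem_filter] at hK
        simp only [Finset.coe_Ico, Set.mem_Ico]
        omega
      · intro K hK L hL hKL
        rw [Finset.mem_coe, h𝒯, Finset.mem_filter] at hK hL
        exact eq_of_mem_of_scale_eq (hK.2.1 (P.corner_mem ω)) (hL.2.1 (P.corner_mem ω)) hKL
    simpa using this
  rw [hsub]
  have hI0 : 0 ≤ ∫ x in P.toSet ω, ‖φ x‖ := integral_nonneg fun _ => norm_nonneg _
  have hterm : ∀ K ∈ 𝒯, ‖avgForm ω i j a K (oscillation ω φ P) ψ‖ ≤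
      2 * 4 ^ d * b * ∫ x in P.toSet ω, ‖φ x‖ := by
    intro K hK
    have hKQ := (Finset.mem_filter.mp hK).1
    have hK0 := volume_real_pos (ω := ω) K
    refine (norm_avgForm_le ha (integrableOnCubes_of_integrable (integrable_oscillation hφ P))
      hψ K).trans ?_
    have e1 : ∫ x in K.toSet ω, ‖oscillation ω φ P x‖ ≤ 2 * ∫ x in P.toSet ω, ‖φ x‖ :=
      (setIntegral_le_integral (integrable_oscillation hφ P).norm
        (ae_of_all _ fun _ => norm_nonneg _)).trans (integral_norm_oscillation_le hφ P)
    calc _ ≤ 4 ^ d / volume.real (K.toSet ω) *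
          ((2 * ∫ x in P.toSet ω, ‖φ x‖) * (b * volume.real (K.toSet ω))) := by
          have := hb K hKQ
          have : 0 ≤ ∫ x in K.toSet ω, ‖ψ x‖ := integral_nonneg fun _ => norm_nonneg _
          gcongr
      _ = _ := by field_simp
  refine (norm_sum_le_of_le _ hterm).trans ?_
  rw [Finset.sum_const, nsmul_eq_mul]
  have : (𝒯.card : ℝ) ≤ i := by exact_mod_cast hcard
  calc (𝒯.card : ℝ) * (2 * 4 ^ d * b * ∫ x in P.toSet ω, ‖φ x‖)
      ≤ i * (2 * 4 ^ d * b * ∫ x in P.toSet ω, ‖φ x‖) := by gcongr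
    _ = _ := by ring

/-! ### The local estimate for a shift -/

lemma integrable_avgOp_mul {ψ : (Fin d → ℝ) → ℂ} (hψ : IntegrableOnCubes ω ψ) (i j : ℕ)
    (a : Coefficients d) (K : DyadicCube d) (φ : (Fin d → ℝ) → ℂ) :
    Integrable (fun x => avgOp ω i j a K φ x * ψ x) ∧
      ∫ x, avgOp ω i j a K φ x * ψ x = avgForm ω i j a K φ ψ := by
  have hterm : ∀ I J η θ, Integrable fun x => a I J K η θ *
      (∫ y, φ y * (haar ω I η y : ℂ)) * (haar ω J θ x : ℂ) * ψ x := by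
    intro I J η θ
    refine ((hψ.integrable_mul_haar J θ).const_mul
      (a I J K η θ * ∫ y, φ y * (haar ω I η y : ℂ))).congr (ae_of_all _ fun x => ?_)
    simp only; ring
  have hint : ∀ I J η θ, ∫ x, a I J K η θ * (∫ y, φ y * (haar ω I η y : ℂ)) *
      (haar ω J θ x : ℂ) * ψ x = a I J K η θ * haarCoeff ω φ I η * haarCoeff ω ψ J θ := by
    intro I J η θ
    unfold haarCoeff
    rw [← integral_const_mul (a I J K η θ * ∫ y, φ y * (haar ω I η y : ℂ))]
    congr 1
    ext x
    ring
  simp only [avgOp, avgForm, Finset.sum_mul]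
  refine ⟨integrable_finsetSum _ fun I _ => integrable_finsetSum _ fun J _ =>
    integrable_finsetSum _ fun η _ => integrable_finsetSum _ fun θ _ => hterm I J η θ, ?_⟩
  rw [integral_finsetSum _ fun I _ => integrable_finsetSum _ fun J _ =>
    integrable_finsetSum _ fun η _ => integrable_finsetSum _ fun θ _ => hterm I J η θ]
  refine Finset.sum_congr rfl fun I _ => ?_
  rw [integral_finsetSum _ fun J _ =>
    integrable_finsetSum _ fun η _ => integrable_finsetSum _ fun θ _ => hterm I J η θ]
  refine Finset.sum_congr rfl fun J _ => ?_
  rw [integral_finsetSum _ fun η _ => integrable_finsetSum _ fun θ _ => hterm I J η θ]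
  refine Finset.sum_congr rfl fun η _ => ?_
  rw [integral_finsetSum _ fun θ _ => hterm I J η θ]
  exact Finset.sum_congr rfl fun θ _ => hint I J η θ

/-- This is where the unweighted `L²` bound of the subshifts enters, combined with Hölder's
inequality. -/
lemma norm_sum_avgForm_le_eLpNorm {i j : ℕ} {a : Coefficients d} (ha : IsDyadicShift ω i j a)
    {φ ψ : (Fin d → ℝ) → ℂ} (hφ : MemLp φ 2 volume) (hψ : MemLp ψ 2 volume)
    (hψ' : IntegrableOnCubes ω ψ) (𝒬 : Finset (DyadicCube d)) :
    ‖∑ K ∈ 𝒬, avgForm ω i j a K φ ψ‖ ≤ (eLpNorm φ 2 volume).toReal *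
      (eLpNorm ψ 2 volume).toReal := by
  obtain ⟨g, ⟨hu, hg, hlim⟩, hle⟩ := ha.subshift_le (𝒬 : Set (DyadicCube d)) φ hφ
  -- `𝒬` is finite, so `atTop` is concentrated at the full index set and the limit says that `g`
  -- equals the finite sum almost everywhere.
  rw [OrderTop.atTop_eq] at hlim
  have h0 := tendsto_nhds_unique hlim (tendsto_pure_nhds _ _)
  have hgm : AEStronglyMeasurable (fun x => g x - ∑ K ∈ (⊤ : Finset (𝒬 : Set (DyadicCube d))),
      avgOp ω i j a K φ x) volume := by
    refine hg.aestronglyMeasurable.sub ?_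
    exact Finset.aestronglyMeasurable_fun_sum _ fun K _ => (hu K K.2).aestronglyMeasurable
  rw [eq_comm, eLpNorm_eq_zero_iff hgm two_ne_zero] at h0
  have hsum : ∑ K ∈ 𝒬, avgForm ω i j a K φ ψ = ∫ x, g x * ψ x := by
    simp only [← (integrable_avgOp_mul hψ' i j a _ φ).2]
    rw [← integral_finsetSum _ fun K _ => (integrable_avgOp_mul hψ' i j a K φ).1]
    refine integral_congr_ae ?_
    filter_upwards [h0] with x hx
    rw [sub_eq_zero.mp hx, Finset.sum_mul]
    simp only [Finset.top_eq_univ]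
    exact (Finset.sum_coe_sort 𝒬 fun K => avgOp ω i j a K φ x * ψ x).symm
  rw [hsum, ← ENNReal.toReal_mul]
  have hH : eLpNorm (g • ψ) 1 volume ≤ eLpNorm g 2 volume * eLpNorm ψ 2 volume :=
    eLpNorm_smul_le_mul_eLpNorm hψ.aestronglyMeasurable hg.aestronglyMeasurable
  have hfin : eLpNorm φ 2 volume * eLpNorm ψ 2 volume ≠ ∞ :=
    ENNReal.mul_ne_top hφ.2.ne hψ.2.ne
  have hE : ‖∫ x, g x * ψ x‖ₑ ≤ eLpNorm φ 2 volume * eLpNorm ψ 2 volume := by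
    refine (enorm_integral_le_lintegral_enorm _).trans ?_
    rw [← eLpNorm_one_eq_lintegral_enorm]
    exact hH.trans (mul_le_mul' hle le_rfl)
  rw [← toReal_enorm]
  exact ENNReal.toReal_mono hfin hE

lemma averaged_eq_of_mem {𝒱 : Finset (DyadicCube d)}
    (hdisj : (𝒱 : Set (DyadicCube d)).PairwiseDisjoint (DyadicCube.toSet ω))
    (φ : (Fin d → ℝ) → ℂ) {P : DyadicCube d} (hP : P ∈ 𝒱) {x : Fin d → ℝ}
    (hx : x ∈ P.toSet ω) : averaged ω 𝒱 φ x = cubeAvg ω φ P := by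
  have hout : ∀ R ∈ 𝒱, R ≠ P → x ∉ R.toSet ω := fun R hR hne hxR =>
    Set.disjoint_left.mp (hdisj hR hP hne) hxR hx
  unfold averaged
  rw [Finset.sum_eq_single_of_mem P hP fun R hR hne => by simp [hout R hR hne]]
  simp [hx]

lemma averaged_eq_zero {𝒱 : Finset (DyadicCube d)} (φ : (Fin d → ℝ) → ℂ) {x : Fin d → ℝ}
    (hx : ∀ P ∈ 𝒱, x ∉ P.toSet ω) : averaged ω 𝒱 φ x = 0 :=
  Finset.sum_eq_zero fun P hP => by simp [hx P hP]

/-- `𝒱` consists of the maximal subcubes of `Q₀` that contain no cube of `𝒬`. Since `Q₀` itself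
contains one, each `P ∈ 𝒱` has its parent inside `Q₀`, and by maximality the parent contains a cube
of `𝒬`. That is what later transfers bounds on averages from the parent to `P`. -/
lemma exists_partition [NeZero d] (Q₀ : DyadicCube d) {𝒬 : Finset (DyadicCube d)}
    (hne : 𝒬.Nonempty) (hsub : ∀ K ∈ 𝒬, K.toSet ω ⊆ Q₀.toSet ω) :
    ∃ 𝒱 : Finset (DyadicCube d),
      (𝒱 : Set (DyadicCube d)).PairwiseDisjoint (DyadicCube.toSet ω) ∧
      (∀ P ∈ 𝒱, P.toSet ω ⊆ Q₀.toSet ω) ∧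
      (∀ x ∈ Q₀.toSet ω, ∃ P ∈ 𝒱, x ∈ P.toSet ω) ∧
      (∀ K ∈ 𝒬, ∀ P ∈ 𝒱, ∀ x ∈ K.toSet ω, x ∈ P.toSet ω → K.scale < P.scale) ∧
      ∀ P ∈ 𝒱, (parent ω P).toSet ω ⊆ Q₀.toSet ω ∧
        ∃ K ∈ 𝒬, K.toSet ω ⊆ (parent ω P).toSet ω := by
  classical
  obtain ⟨L, hL, hmax⟩ := Finset.exists_max_image 𝒬 DyadicCube.scale hne
  -- Cubes of generation `N + 1` are finer than every cube of `𝒬` and hence contain none, so the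
  -- search involves only finitely many generations.
  set N := L.scale
  let 𝒱 := (finite_between (ω := ω) Q₀ (N + 1)).toFinset.filter fun R =>
    (∀ K ∈ 𝒬, ¬ K.toSet ω ⊆ R.toSet ω) ∧ ∃ K ∈ 𝒬, K.toSet ω ⊆ (parent ω R).toSet ω
  have hmem : ∀ R, R ∈ 𝒱 ↔ (R.toSet ω ⊆ Q₀.toSet ω ∧ R.scale ≤ N + 1) ∧
      (∀ K ∈ 𝒬, ¬ K.toSet ω ⊆ R.toSet ω) ∧ ∃ K ∈ 𝒬, K.toSet ω ⊆ (parent ω R).toSet ω :=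
    fun R => by simp [𝒱]
  refine ⟨𝒱, ?_, fun P hP => ((hmem P).mp hP).1.1, ?_, ?_, ?_⟩
  · have key : ∀ R ∈ 𝒱, ∀ S ∈ 𝒱, R ≠ S → ¬ R.toSet ω ⊆ S.toSet ω := by
      intro R hR S hS hRS hsub
      obtain ⟨K, hK, hKR⟩ := ((hmem R).mp hR).2.2
      exact ((hmem S).mp hS).2.1 K hK (hKR.trans (parent_subset hsub hRS))
    intro R hR S hS hRS
    rw [Function.onFun, Set.disjoint_left]
    intro x hx hx'
    rcases subset_or_subset hx hx' with h | h
    · exact key S hS R hR hRS.symm h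
    · exact key R hR S hS hRS h
  · intro x hx
    have hLQ := scale_le_of_subset (hsub L hL)
    have hex : ∃ n : ℕ, ∀ K ∈ 𝒬, ¬ K.toSet ω ⊆ (cubeAt ω (Q₀.scale + n) x).toSet ω := by
      refine ⟨(N + 1 - Q₀.scale).toNat, fun K hK hcon => ?_⟩
      have h1 := scale_le_of_subset hcon
      have h2 := hmax K hK
      rw [cubeAt_scale] at h1
      omega
    -- The first generation below `Q₀` whose cube around `x` contains no cube of `𝒬`. It is not
    -- generation zero, and by minimality the parent of this cube does contain one.
    set n := Nat.find hex with hn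
    have hn1 := Nat.find_spec hex
    have hn2 : (n : ℤ) ≤ N + 1 - Q₀.scale := by
      have : n ≤ (N + 1 - Q₀.scale).toNat := Nat.find_min' hex fun K hK hcon => by
        have h1 := scale_le_of_subset hcon
        have h2 := hmax K hK
        rw [cubeAt_scale] at h1
        omega
      omega
    have hn0 : n ≠ 0 := by
      intro h0
      rw [← hn, h0] at hn1
      refine hn1 L hL ?_
      have : cubeAt ω (Q₀.scale + (0 : ℕ)) x = Q₀ := by simpa using mem_toSet_iff.mp hx
      rw [this]; exact hsub L hL
    have hpar : parent ω (cubeAt ω (Q₀.scale + n) x) = cubeAt ω (Q₀.scale + (n - 1 : ℕ)) x := by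
      refine eq_of_mem_of_scale_eq (subset_parent _ (mem_cubeAt _ x)) (mem_cubeAt _ x) ?_
      rw [parent_scale, cubeAt_scale, cubeAt_scale]
      omega
    refine ⟨cubeAt ω (Q₀.scale + n) x, (hmem _).mpr ⟨⟨?_, ?_⟩, hn1, ?_⟩, mem_cubeAt _ x⟩
    · exact subset_of_mem hx (mem_cubeAt _ x) (by rw [cubeAt_scale]; omega)
    · rw [cubeAt_scale]; omega
    · have := Nat.find_min hex (m := n - 1) (by omega)
      push Not at this
      rwa [hpar]
  · intro K hK P hP x hxK hxP
    by_contra hcon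
    exact ((hmem P).mp hP).2.1 K hK (subset_of_mem hxP hxK (by omega))
  · intro P hP
    obtain ⟨⟨h1, _⟩, h2, h3⟩ := (hmem P).mp hP
    refine ⟨parent_subset h1 ?_, h3⟩
    rintro rfl
    exact h2 L hL (hsub L hL)

lemma memLp_averaged {Q₀ : DyadicCube d} {𝒱 : Finset (DyadicCube d)}
    (hsub : ∀ P ∈ 𝒱, P.toSet ω ⊆ Q₀.toSet ω) {φ : (Fin d → ℝ) → ℂ} {s : ℝ} (hs : 0 ≤ s)
    (hle : ∀ x, ‖averaged ω 𝒱 φ x‖ ≤ s) :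
    MemLp (averaged ω 𝒱 φ) 2 volume ∧
      (eLpNorm (averaged ω 𝒱 φ) 2 volume).toReal ≤ s * √(volume.real (Q₀.toSet ω)) := by
  have hsupp : Function.support (averaged ω 𝒱 φ) ⊆ Q₀.toSet ω := by
    intro x hx
    by_contra hxQ
    exact hx (averaged_eq_zero φ fun P hP hxP => hxQ (hsub P hP hxP))
  have hb : eLpNorm (averaged ω 𝒱 φ) 2 volume ≤
      volume (Q₀.toSet ω) ^ (2 : ℝ)⁻¹ * ENNReal.ofReal s := by
    rw [← eLpNorm_restrict_eq_of_support_subset hsupp]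
    refine (eLpNorm_le_of_ae_bound (ae_of_all _ hle)).trans (le_of_eq ?_)
    simp
  have hfin : volume (Q₀.toSet ω) ^ (2 : ℝ)⁻¹ * ENNReal.ofReal s ≠ ∞ :=
    ENNReal.mul_ne_top (ENNReal.rpow_ne_top_of_nonneg (by norm_num) (volume_ne_top Q₀))
      ENNReal.ofReal_ne_top
  refine ⟨⟨(integrable_averaged 𝒱 φ).aestronglyMeasurable, hb.trans_lt hfin.lt_top⟩, ?_⟩
  refine (ENNReal.toReal_mono hfin hb).trans (le_of_eq ?_)
  rw [ENNReal.toReal_mul, ENNReal.toReal_ofReal hs, ← ENNReal.toReal_rpow, Real.sqrt_eq_rpow,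
    mul_comm, measureReal_def, one_div]

/-- The local estimate: on a cube `Q₀` where all averages of `φ`, `ψ` over cubes between `Q₀`
and a cube of `𝒬` are at most `s`, `t`. -/
lemma norm_sum_avgForm_local [NeZero d] {i j : ℕ} {a : Coefficients d}
    (ha : IsDyadicShift ω i j a) {φ ψ : (Fin d → ℝ) → ℂ} (hφ : IntegrableOnCubes ω φ)
    (hψ : IntegrableOnCubes ω ψ) (Q₀ : DyadicCube d) {𝒬 : Finset (DyadicCube d)}
    (hsub : ∀ K ∈ 𝒬, K.toSet ω ⊆ Q₀.toSet ω) {s t : ℝ} (hs : 0 ≤ s) (ht : 0 ≤ t)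
    (hs' : ∀ K ∈ 𝒬, ∀ R : DyadicCube d, K.toSet ω ⊆ R.toSet ω → R.toSet ω ⊆ Q₀.toSet ω →
      ∫ x in R.toSet ω, ‖φ x‖ ≤ s * volume.real (R.toSet ω))
    (ht' : ∀ K ∈ 𝒬, ∀ R : DyadicCube d, K.toSet ω ⊆ R.toSet ω → R.toSet ω ⊆ Q₀.toSet ω →
      ∫ x in R.toSet ω, ‖ψ x‖ ≤ t * volume.real (R.toSet ω)) :
    ‖∑ K ∈ 𝒬, avgForm ω i j a K φ ψ‖ ≤
      4 * 8 ^ d * (1 + (max i j : ℕ)) * (s * t * volume.real (Q₀.toSet ω)) := by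
  rcases 𝒬.eq_empty_or_nonempty with rfl | hne
  · simp only [Finset.sum_empty, norm_zero]; positivity
  obtain ⟨𝒱, hdisj, hVQ, hcov, hlt, hpar⟩ := exists_partition Q₀ hne hsub
  have hcov' : ∀ K ∈ 𝒬, ∀ x ∈ K.toSet ω, ∃ P ∈ 𝒱, x ∈ P.toSet ω :=
    fun K hK x hx => hcov x (hsub K hK hx)
  have hbound : ∀ {χ : (Fin d → ℝ) → ℂ} {u : ℝ}, IntegrableOnCubes ω χ → 0 ≤ u →
      (∀ K ∈ 𝒬, ∀ R : DyadicCube d, K.toSet ω ⊆ R.toSet ω → R.toSet ω ⊆ Q₀.toSet ω →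
        ∫ x in R.toSet ω, ‖χ x‖ ≤ u * volume.real (R.toSet ω)) →
      (∀ x, ‖averaged ω 𝒱 χ x‖ ≤ 2 ^ d * u) ∧
        ∑ P ∈ 𝒱, ∫ x in P.toSet ω, ‖χ x‖ ≤ u * volume.real (Q₀.toSet ω) := by
    intro χ u hχ hu h
    refine ⟨fun x => ?_, ?_⟩
    · by_cases hx : ∃ P ∈ 𝒱, x ∈ P.toSet ω
      · obtain ⟨P, hP, hxP⟩ := hx
        rw [averaged_eq_of_mem hdisj χ hP hxP]
        -- The hypothesis bounds the average over the parent of `P`, not over `P`; passing to `P`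
        -- costs the volume ratio `2 ^ d`.
        obtain ⟨hp1, K, hK, hp2⟩ := hpar P hP
        have h1 := h K hK _ hp2 hp1
        rw [volume_real_parent] at h1
        have h2 := setIntegral_mono_set (hχ (parent ω P)).norm
          (ae_of_all _ fun x => norm_nonneg (χ x)) (LE.le.eventuallyLE (subset_parent P))
        have h3 := norm_cubeAvg_mul_le (ω := ω) χ P
        have hP0 := volume_real_pos (ω := ω) P
        refine le_of_mul_le_mul_right ?_ hP0
        linarith
      · push Not at hx
        rw [averaged_eq_zero χ hx, norm_zero]; positivity
    · obtain ⟨K, hK⟩ := hne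
      refine (sum_setIntegral_le (fun P _ => measurableSet_toSet P) hdisj hVQ
        (fun _ => norm_nonneg _) (hχ Q₀).norm).trans ?_
      exact h K hK Q₀ (hsub K hK) subset_rfl
  obtain ⟨hφ1, hφ2⟩ := hbound hφ hs hs'
  obtain ⟨hψ1, hψ2⟩ := hbound hψ ht ht'
  set φ' := averaged ω 𝒱 φ with hφ'
  set ψ' := averaged ω 𝒱 ψ with hψ'
  have hφi : IntegrableOnCubes ω φ' := integrableOnCubes_of_integrable (integrable_averaged 𝒱 φ)
  have hψi : IntegrableOnCubes ω ψ' := integrableOnCubes_of_integrable (integrable_averaged 𝒱 ψ)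
  obtain ⟨hφL, hφn⟩ := memLp_averaged (ω := ω) (φ := φ) hVQ (by positivity) hφ1
  obtain ⟨hψL, hψn⟩ := memLp_averaged (ω := ω) (φ := ψ) hVQ (by positivity) hψ1
  have hsize : SizeCondition ω i j a := ha.coeff_le
  -- First `φ` is replaced by `φ'`, then `ψ` by `ψ'` through the transposed shift, with `‖φ'‖ ≤ 2 ^
  -- d * s` as the bounded factor; the `L²` bound handles what remains. The three costs `2·8^d κ`,
  -- `2·8^d κ` and `8^d`, times `stV`, add up to at most `4·8^d(1+κ)stV`.
  have step1 := norm_sum_avgForm_sub_le hsize hφ hψ hdisj hcov' hlt ht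
    fun K hK => ht' K hK K subset_rfl (hsub K hK)
  have step2 := norm_sum_avgForm_sub_le hsize.transpose hψ hφi hdisj hcov' hlt
    (b := 2 ^ d * s) (by positivity) fun K hK => by
      calc ∫ x in K.toSet ω, ‖φ' x‖ ≤ ∫ _ in K.toSet ω, (2 ^ d * s : ℝ) :=
            integral_mono (hφi K).norm (integrableOn_const (volume_ne_top K)) hφ1
        _ = _ := by rw [setIntegral_const, smul_eq_mul, mul_comm]
  simp only [avgForm_transpose] at step2
  have step3 := norm_sum_avgForm_le_eLpNorm ha hφL hψL hψi 𝒬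
  set V := volume.real (Q₀.toSet ω) with hV
  have hV0 : 0 < V := volume_real_pos Q₀
  set κ : ℝ := ((max i j : ℕ) : ℝ) with hκ
  have hiκ : (i : ℝ) ≤ κ := by rw [hκ]; exact_mod_cast le_max_left i j
  have hjκ : (j : ℝ) ≤ κ := by rw [hκ]; exact_mod_cast le_max_right i j
  have hκ0 : 0 ≤ κ := by positivity
  have e1 : 2 * 4 ^ d * i * t * ∑ P ∈ 𝒱, ∫ x in P.toSet ω, ‖φ x‖ ≤
      2 * 8 ^ d * κ * (s * t * V) := by
    calc _ ≤ 2 * 4 ^ d * i * t * (s * V) := by gcongr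
      _ ≤ 2 * 8 ^ d * κ * t * (s * V) := by gcongr; norm_num
      _ = _ := by ring
  have e2 : 2 * 4 ^ d * j * (2 ^ d * s) * ∑ P ∈ 𝒱, ∫ x in P.toSet ω, ‖ψ x‖ ≤
      2 * 8 ^ d * κ * (s * t * V) := by
    have h8 : (8 : ℝ) ^ d = 4 ^ d * 2 ^ d := by rw [← mul_pow]; norm_num
    calc _ ≤ 2 * 4 ^ d * κ * (2 ^ d * s) * (t * V) := by gcongr
      _ = _ := by rw [h8]; ring
  have e3 : (eLpNorm φ' 2 volume).toReal * (eLpNorm ψ' 2 volume).toReal ≤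
      8 ^ d * (s * t * V) := by
    calc _ ≤ (2 ^ d * s * √V) * (2 ^ d * t * √V) := by gcongr
      _ = (2 ^ d * 2 ^ d) * (s * t * (√V * √V)) := by ring
      _ = 4 ^ d * (s * t * V) := by rw [Real.mul_self_sqrt hV0.le, ← mul_pow]; norm_num
      _ ≤ _ := by gcongr; norm_num
  have e4 : 0 ≤ 8 ^ d * (s * t * V) := by positivity
  have tri : ‖∑ K ∈ 𝒬, avgForm ω i j a K φ ψ‖ ≤
      ‖∑ K ∈ 𝒬, avgForm ω i j a K φ ψ - ∑ K ∈ 𝒬, avgForm ω i j a K φ' ψ‖ +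
      ‖∑ K ∈ 𝒬, avgForm ω i j a K φ' ψ - ∑ K ∈ 𝒬, avgForm ω i j a K φ' ψ'‖ +
      ‖∑ K ∈ 𝒬, avgForm ω i j a K φ' ψ'‖ := by
    refine le_trans (le_of_eq ?_) (norm_add₃_le)
    congr 1; ring
  have hfin := tri.trans (add_le_add (add_le_add (step1.trans e1) (step2.trans e2))
    (step3.trans e3))
  refine hfin.trans ?_
  linarith

/-! ### Principal cubes -/

lemma exists_minimal_cube {𝓢 : Finset (DyadicCube d)} {R : DyadicCube d}
    (h : ∃ S ∈ 𝓢, R.toSet ω ⊆ S.toSet ω) :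
    ∃ S ∈ 𝓢, R.toSet ω ⊆ S.toSet ω ∧
      ∀ S' ∈ 𝓢, R.toSet ω ⊆ S'.toSet ω → S.toSet ω ⊆ S'.toSet ω := by
  classical
  obtain ⟨S, hS, hmax⟩ := Finset.exists_max_image
    (𝓢.filter fun S => R.toSet ω ⊆ S.toSet ω) DyadicCube.scale
    (by obtain ⟨S, hS, hRS⟩ := h; exact ⟨S, Finset.mem_filter.mpr ⟨hS, hRS⟩⟩)
  rw [Finset.mem_filter] at hS
  refine ⟨S, hS.1, hS.2, fun S' hS' hRS' => ?_⟩
  exact subset_of_mem (hRS' (R.corner_mem ω)) (hS.2 (R.corner_mem ω))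
    (hmax S' (Finset.mem_filter.mpr ⟨hS', hRS'⟩))

/-- Principal cubes of a finite family, for an arbitrary reflexive relation `good`. -/
lemma exists_principal [NeZero d] (ω : ℤ → Fin d → Fin 2) (𝒯 : Finset (DyadicCube d))
    {good : DyadicCube d → DyadicCube d → Prop} (hrefl : ∀ R, good R R) :
    ∃ 𝓢 ⊆ 𝒯,
      (∀ R ∈ 𝒯, ∃ P ∈ 𝓢, R.toSet ω ⊆ P.toSet ω ∧ good R P ∧
        ∀ S ∈ 𝓢, R.toSet ω ⊆ S.toSet ω → P.toSet ω ⊆ S.toSet ω) ∧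
      ∀ S ∈ 𝓢, ∀ S' ∈ 𝓢, S.toSet ω ⊆ S'.toSet ω → S ≠ S' →
        ∃ S'' ∈ 𝓢, S.toSet ω ⊆ S''.toSet ω ∧ S''.toSet ω ⊆ S'.toSet ω ∧ S'' ≠ S' ∧
          ¬ good S'' S' := by
  classical
  -- Cubes are inserted from large to small. A new cube joins `𝓢` exactly when the smallest cube of
  -- `𝓢` above it does not serve it as `good`. It contains no earlier cube, so earlier choices
  -- survive. As `good` need not be transitive, the chain clause asserts its failure only at some
  -- intermediate `S''`.
  refine Finset.induction_on_max_value DyadicCube.scale 𝒯 ⟨∅, by simp, by simp, by simp⟩ ?_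
  · intro R₀ s hR₀ hmax ih
    obtain ⟨𝓢, hsub, hprin, hchain⟩ := ih
    have hnot : ∀ R ∈ s, ¬ R.toSet ω ⊆ R₀.toSet ω := fun R hR hcon =>
      hR₀ (eq_of_mem_of_scale_eq (R.corner_mem ω) (hcon (R.corner_mem ω))
        (le_antisymm (hmax R hR) (scale_le_of_subset hcon)) ▸ hR)
    by_cases hA : ∃ P ∈ 𝓢, R₀.toSet ω ⊆ P.toSet ω ∧ good R₀ P ∧
        ∀ S ∈ 𝓢, R₀.toSet ω ⊆ S.toSet ω → P.toSet ω ⊆ S.toSet ω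
    · refine ⟨𝓢, hsub.trans (Finset.subset_insert _ _), ?_, hchain⟩
      intro R hR
      rcases Finset.mem_insert.mp hR with rfl | hR
      · exact hA
      · exact hprin R hR
    · refine ⟨insert R₀ 𝓢, Finset.insert_subset_insert _ hsub, ?_, ?_⟩
      · intro R hR
        rcases Finset.mem_insert.mp hR with rfl | hR
        · exact ⟨R, Finset.mem_insert_self _ _, subset_rfl, hrefl R, fun S _ h => h⟩
        · have hRs := hR
          obtain ⟨P, hP, h1, h2, h3⟩ := hprin R hR
          refine ⟨P, Finset.mem_insert_of_mem hP, h1, h2, fun S hS hRS => ?_⟩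
          rcases Finset.mem_insert.mp hS with rfl | hS
          · exact absurd hRS (hnot R hRs)
          · exact h3 S hS hRS
      · intro S hS S' hS' hSS' hne
        rcases Finset.mem_insert.mp hS' with rfl | hS'
        · rcases Finset.mem_insert.mp hS with rfl | hS
          · exact absurd rfl hne
          · exact absurd hSS' (hnot S (hsub hS))
        have hS'𝓢 := hS'
        rcases Finset.mem_insert.mp hS with rfl | hS
        · obtain ⟨S₀, hS₀, h1, h2⟩ := exists_minimal_cube (𝓢 := 𝓢) ⟨S', hS'𝓢, hSS'⟩
          -- If `S'` is directly above the new cube, that cube was added because `good` failed, and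
          -- it is its own witness. Otherwise the witness comes from the older pair `S₀`, `S'`.
          by_cases h0 : S₀ = S'
          · subst h0
            exact ⟨S, Finset.mem_insert_self _ _, subset_rfl, hSS', hne,
              fun hg => hA ⟨S₀, hS₀, h1, hg, h2⟩⟩
          · obtain ⟨S'', hS'', h3, h4, h5, h6⟩ := hchain S₀ hS₀ S' hS'𝓢 (h2 S' hS'𝓢 hSS') h0
            exact ⟨S'', Finset.mem_insert_of_mem hS'', h1.trans h3, h4, h5, h6⟩
        · obtain ⟨S'', hS'', h3⟩ := hchain S hS S' hS' hSS' hne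
          exact ⟨S'', Finset.mem_insert_of_mem hS'', h3⟩

/-! ### Sparse families -/

/-- The part of `S` that is not covered by the smaller cubes of `𝓢`. -/
def sparsePart (ω : ℤ → Fin d → Fin 2) (𝓢 : Finset (DyadicCube d)) (S : DyadicCube d) :
    Set (Fin d → ℝ) :=
  S.toSet ω \ ⋃ R ∈ 𝓢, ⋃ (_ : R.toSet ω ⊆ S.toSet ω ∧ R ≠ S), R.toSet ω

/-- A finite family of cubes is sparse. -/
def IsSparse (ω : ℤ → Fin d → Fin 2) (𝓢 : Finset (DyadicCube d)) : Prop :=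
  ∀ S ∈ 𝓢, volume (S.toSet ω) ≤ 2 * volume (sparsePart ω 𝓢 S)

lemma measurableSet_sparsePart (𝓢 : Finset (DyadicCube d)) (S : DyadicCube d) :
    MeasurableSet (sparsePart ω 𝓢 S) :=
  (measurableSet_toSet S).diff (Finset.measurableSet_biUnion _ fun R _ =>
    MeasurableSet.iUnion fun _ => measurableSet_toSet R)

lemma disjoint_sparsePart {𝓢 : Finset (DyadicCube d)} :
    (𝓢 : Set (DyadicCube d)).PairwiseDisjoint (sparsePart ω 𝓢) := by
  have key : ∀ R ∈ 𝓢, ∀ S, R ≠ S → R.toSet ω ⊆ S.toSet ω → ∀ x ∈ sparsePart ω 𝓢 R,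
      x ∉ sparsePart ω 𝓢 S := by
    intro R hR S hne hsub x hx hx'
    refine hx'.2 ?_
    simp only [Set.mem_iUnion]
    exact ⟨R, hR, ⟨hsub, hne⟩, hx.1⟩
  intro R hR S hS hne
  rw [Function.onFun, Set.disjoint_left]
  intro x hx hx'
  rcases subset_or_subset hx.1 hx'.1 with h | h
  · exact key S hS R hne.symm h x hx' hx
  · exact key R hR S hne h x hx hx'

/-- The Carleson packing property of a sparse family. -/
lemma IsSparse.sum_mul_volume_le {𝓢 𝓣 : Finset (DyadicCube d)} (h : IsSparse ω 𝓢)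
    (h𝓣 : 𝓣 ⊆ 𝓢) {F : DyadicCube d} (hF : ∀ S ∈ 𝓣, S.toSet ω ⊆ F.toSet ω)
    {c : DyadicCube d → ℝ≥0∞} {g : (Fin d → ℝ) → ℝ≥0∞}
    (hc : ∀ S ∈ 𝓣, ∀ x ∈ S.toSet ω, c S ≤ g x) :
    ∑ S ∈ 𝓣, c S * volume (S.toSet ω) ≤ 2 * ∫⁻ x in F.toSet ω, g x := by
  -- Each `|S|` is traded for twice the measure of its sparse part. These parts are disjoint, and `g
  -- ≥ c S` on them.
  calc ∑ S ∈ 𝓣, c S * volume (S.toSet ω)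
      ≤ ∑ S ∈ 𝓣, 2 * ∫⁻ x in sparsePart ω 𝓢 S, g x := by
        refine Finset.sum_le_sum fun S hS => ?_
        calc c S * volume (S.toSet ω) ≤ c S * (2 * volume (sparsePart ω 𝓢 S)) := by
              gcongr; exact h S (h𝓣 hS)
          _ = 2 * ∫⁻ _ in sparsePart ω 𝓢 S, c S := by
              rw [setLIntegral_const]; ring
          _ ≤ _ := by
              gcongr 2 * ?_
              exact setLIntegral_mono' (measurableSet_sparsePart 𝓢 S)
                fun x hx => hc S hS x hx.1
    _ = 2 * ∫⁻ x in ⋃ S ∈ 𝓣, sparsePart ω 𝓢 S, g x := by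
        rw [← Finset.mul_sum, lintegral_biUnion_finset
          (disjoint_sparsePart.subset (by exact_mod_cast h𝓣))
          fun S _ => measurableSet_sparsePart 𝓢 S]
    _ ≤ _ := by
        gcongr
        exact Set.iUnion₂_subset fun S hS => Set.sdiff_subset.trans (hF S hS)

lemma exists_disjoint_subfamily [NeZero d] (ω : ℤ → Fin d → Fin 2)
    (𝓡 : Finset (DyadicCube d)) :
    ∃ 𝓡' ⊆ 𝓡, (𝓡' : Set (DyadicCube d)).PairwiseDisjoint (DyadicCube.toSet ω) ∧
      ∀ R ∈ 𝓡, ∃ R' ∈ 𝓡', R.toSet ω ⊆ R'.toSet ω := by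
  classical
  refine ⟨𝓡.filter fun R => ∀ R' ∈ 𝓡, R.toSet ω ⊆ R'.toSet ω → R' = R,
    Finset.filter_subset _ _, ?_, fun R hR => ?_⟩
  · intro R hR S hS hne
    rw [Finset.mem_coe, Finset.mem_filter] at hR hS
    rw [Function.onFun, Set.disjoint_left]
    intro x hx hx'
    rcases subset_or_subset hx hx' with h | h
    · exact hne (hS.2 R hR.1 h)
    · exact hne (hR.2 S hS.1 h).symm
  · obtain ⟨S, hS, hmin⟩ := Finset.exists_min_image
      (𝓡.filter fun S => R.toSet ω ⊆ S.toSet ω) DyadicCube.scale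
      ⟨R, Finset.mem_filter.mpr ⟨hR, subset_rfl⟩⟩
    rw [Finset.mem_filter] at hS
    refine ⟨S, Finset.mem_filter.mpr ⟨hS.1, fun R' hR' hsub => ?_⟩, hS.2⟩
    have h1 := hmin R' (Finset.mem_filter.mpr ⟨hR', hS.2.trans hsub⟩)
    exact (eq_of_mem_of_scale_eq (S.corner_mem ω) (hsub (S.corner_mem ω))
      (le_antisymm h1 (scale_le_of_subset hsub))).symm

/-- The weak type estimate of the dyadic maximal operator, for finite families. -/
lemma mul_volume_biUnion_le [NeZero d] {𝓡 : Finset (DyadicCube d)} {Q : DyadicCube d}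
    (hsub : ∀ R ∈ 𝓡, R.toSet ω ⊆ Q.toSet ω) {f : (Fin d → ℝ) → ℝ} (hf : ∀ x, 0 ≤ f x)
    (hi : IntegrableOn f (Q.toSet ω)) {c : ℝ} (hc0 : 0 ≤ c)
    (hc : ∀ R ∈ 𝓡, c * volume.real (R.toSet ω) ≤ ∫ x in R.toSet ω, f x) :
    c * volume.real (⋃ R ∈ 𝓡, R.toSet ω) ≤ ∫ x in Q.toSet ω, f x := by
  obtain ⟨𝓡', h1, h2, h3⟩ := exists_disjoint_subfamily ω 𝓡
  have hU : ⋃ R ∈ 𝓡, R.toSet ω ⊆ ⋃ R ∈ 𝓡', R.toSet ω := by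
    refine Set.iUnion₂_subset fun R hR => ?_
    obtain ⟨R', hR', hRR⟩ := h3 R hR
    exact hRR.trans (Set.subset_biUnion_of_mem (u := fun R => R.toSet ω) hR')
  calc c * volume.real (⋃ R ∈ 𝓡, R.toSet ω) ≤ c * ∑ R ∈ 𝓡', volume.real (R.toSet ω) := by
        gcongr
        rw [← measureReal_biUnion_finset h2 (fun R _ => measurableSet_toSet R)
          (fun R _ => volume_ne_top R)]
        refine measureReal_mono hU (ne_of_lt ?_)
        exact (measure_biUnion_finset_le _ _).trans_lt
          (ENNReal.sum_lt_top.mpr fun R _ => (volume_ne_top R).lt_top)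
    _ ≤ ∑ R ∈ 𝓡', ∫ x in R.toSet ω, f x := by
        rw [Finset.mul_sum]
        exact Finset.sum_le_sum fun R hR => hc R (h1 hR)
    _ ≤ _ := sum_setIntegral_le (fun R _ => measurableSet_toSet R) h2
        (fun R hR => hsub R (h1 hR)) hf hi

/-- The average of `‖φ‖` over a cube. -/
noncomputable def normAvg (ω : ℤ → Fin d → Fin 2) (φ : (Fin d → ℝ) → ℂ) (R : DyadicCube d) : ℝ :=
  (∫ x in R.toSet ω, ‖φ x‖) / volume.real (R.toSet ω)

lemma normAvg_nonneg (φ : (Fin d → ℝ) → ℂ) (R : DyadicCube d) : 0 ≤ normAvg ω φ R :=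
  div_nonneg (integral_nonneg fun _ => norm_nonneg _) (volume_real_pos R).le

lemma normAvg_mul (φ : (Fin d → ℝ) → ℂ) (R : DyadicCube d) :
    normAvg ω φ R * volume.real (R.toSet ω) = ∫ x in R.toSet ω, ‖φ x‖ :=
  div_mul_cancel₀ _ (volume_real_pos R).ne'

/-- The weak type estimate at the level of four times the average over `Q`. If that average
vanishes, the strict inequality leaves no cube in `𝓡`. -/
lemma volume_biUnion_normAvg_le [NeZero d] {φ : (Fin d → ℝ) → ℂ} (hφ : IntegrableOnCubes ω φ)
    {𝓡 : Finset (DyadicCube d)} {Q : DyadicCube d} (hsub : ∀ R ∈ 𝓡, R.toSet ω ⊆ Q.toSet ω)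
    (h : ∀ R ∈ 𝓡, 4 * normAvg ω φ Q < normAvg ω φ R) :
    4 * volume.real (⋃ R ∈ 𝓡, R.toSet ω) ≤ volume.real (Q.toSet ω) := by
  have hQ0 := normAvg_nonneg (ω := ω) φ Q
  have key := mul_volume_biUnion_le hsub (fun x => norm_nonneg (φ x)) (hφ Q).norm
    (c := 4 * normAvg ω φ Q) (by positivity) fun R hR => by
      rw [← normAvg_mul]
      exact mul_le_mul_of_nonneg_right (h R hR).le (volume_real_pos R).le
  rcases hQ0.eq_or_lt with h0 | hpos
  · have : 𝓡 = ∅ := by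
      rw [Finset.eq_empty_iff_forall_notMem]
      intro R hR
      have h1 := h R hR
      have h2 := setIntegral_mono_set (hφ Q).norm (ae_of_all _ fun x => norm_nonneg (φ x))
        (LE.le.eventuallyLE (hsub R hR))
      rw [← normAvg_mul, ← normAvg_mul, ← h0, zero_mul] at h2
      rw [← h0, mul_zero] at h1
      exact absurd h2 (not_le.mpr (mul_pos h1 (volume_real_pos R)))
    rw [this]; simp
  · rw [← normAvg_mul] at key
    refine le_of_mul_le_mul_left ?_ hpos
    linarith

/-- Sparse domination of the bilinear form of a dyadic shift. -/
lemma exists_sparse_bound [NeZero d] {i j : ℕ} {a : Coefficients d} (ha : IsDyadicShift ω i j a)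
    {φ ψ : (Fin d → ℝ) → ℂ} (hφ : IntegrableOnCubes ω φ) (hψ : IntegrableOnCubes ω ψ)
    (𝒬 : Finset (DyadicCube d)) :
    ∃ 𝓢 : Finset (DyadicCube d), IsSparse ω 𝓢 ∧ ‖∑ K ∈ 𝒬, avgForm ω i j a K φ ψ‖ ≤
      64 * 8 ^ d * (1 + (max i j : ℕ)) * ∑ S ∈ 𝓢,
        (∫ x in S.toSet ω, ‖φ x‖) * (∫ x in S.toSet ω, ‖ψ x‖) / volume.real (S.toSet ω) := by
  classical
  obtain ⟨N, hN⟩ : ∃ N : ℤ, ∀ K ∈ 𝒬, K.scale ≤ N := by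
    obtain ⟨N, hN⟩ := (𝒬.image DyadicCube.scale).bddAbove
    exact ⟨N, fun K hK => hN (Finset.mem_coe.mpr (Finset.mem_image_of_mem _ hK))⟩
  -- All cubes lying between two cubes of `𝒬`. The stopping procedure runs on this family rather
  -- than on `𝒬`, since the local estimate needs the averages over every cube between `K` and its
  -- principal cube.
  let 𝒯 := (𝒬.biUnion fun K' => (finite_between (ω := ω) K' N).toFinset).filter fun R =>
    ∃ K ∈ 𝒬, K.toSet ω ⊆ R.toSet ω
  have hmem : ∀ R, R ∈ 𝒯 ↔ (∃ K' ∈ 𝒬, R.toSet ω ⊆ K'.toSet ω) ∧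
      ∃ K ∈ 𝒬, K.toSet ω ⊆ R.toSet ω := by
    intro R
    simp only [𝒯, Finset.mem_filter, Finset.mem_biUnion, Set.Finite.mem_toFinset,
      Set.mem_ofPred_eq]
    constructor
    · rintro ⟨⟨K', h1, h2, _⟩, h3⟩
      exact ⟨⟨K', h1, h2⟩, h3⟩
    · rintro ⟨⟨K', h1, h2⟩, K, h3, h4⟩
      exact ⟨⟨K', h1, h2, (scale_le_of_subset h4).trans (hN K h3)⟩, K, h3, h4⟩
  obtain ⟨𝓢, hS𝒯, hprin, hchain⟩ := exists_principal ω 𝒯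
    (good := fun R S => normAvg ω φ R ≤ 4 * normAvg ω φ S ∧ normAvg ω ψ R ≤ 4 * normAvg ω ψ S)
    fun R => ⟨by linarith [normAvg_nonneg (ω := ω) φ R],
      by linarith [normAvg_nonneg (ω := ω) ψ R]⟩
  have hπ : ∀ R : DyadicCube d, ∃ P, R ∈ 𝒯 → P ∈ 𝓢 ∧ R.toSet ω ⊆ P.toSet ω ∧
      (normAvg ω φ R ≤ 4 * normAvg ω φ P ∧ normAvg ω ψ R ≤ 4 * normAvg ω ψ P) ∧
      ∀ S ∈ 𝓢, R.toSet ω ⊆ S.toSet ω → P.toSet ω ⊆ S.toSet ω := by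
    intro R
    by_cases hR : R ∈ 𝒯
    · obtain ⟨P, hP⟩ := hprin R hR
      exact ⟨P, fun _ => hP⟩
    · exact ⟨R, fun h => absurd h hR⟩
  choose π hπ using hπ
  have h𝒬𝒯 : 𝒬 ⊆ 𝒯 := fun K hK => (hmem K).mpr ⟨⟨K, hK, subset_rfl⟩, K, hK, subset_rfl⟩
  refine ⟨𝓢, ?_, ?_⟩
  · intro Q hQ
    set U := ⋃ R ∈ 𝓢, ⋃ (_ : R.toSet ω ⊆ Q.toSet ω ∧ R ≠ Q), R.toSet ω with hU
    -- A smaller cube of `𝓢` inside `Q` lies in one where the average of `φ` or that of `ψ` has more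
    -- than quadrupled. Each alternative covers at most a quarter of `Q`, so at least half of `Q`
    -- remains.
    set 𝓡₁ := 𝓢.filter fun R => R.toSet ω ⊆ Q.toSet ω ∧ 4 * normAvg ω φ Q < normAvg ω φ R
      with h𝓡₁
    set 𝓡₂ := 𝓢.filter fun R => R.toSet ω ⊆ Q.toSet ω ∧ 4 * normAvg ω ψ Q < normAvg ω ψ R
      with h𝓡₂
    have hUsub : U ⊆ (⋃ R ∈ 𝓡₁, R.toSet ω) ∪ ⋃ R ∈ 𝓡₂, R.toSet ω := by
      refine Set.iUnion₂_subset fun R hR => Set.iUnion_subset fun hRQ => ?_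
      obtain ⟨S, hS, h1, h2, _, h4⟩ := hchain R hR Q hQ hRQ.1 hRQ.2
      rw [not_and_or, not_le, not_le] at h4
      rcases h4 with h4 | h4
      · exact (h1.trans (Set.subset_biUnion_of_mem (u := fun R => R.toSet ω)
          (Finset.mem_coe.mpr (Finset.mem_filter.mpr ⟨hS, h2, h4⟩)))).trans
          Set.subset_union_left
      · exact (h1.trans (Set.subset_biUnion_of_mem (u := fun R => R.toSet ω)
          (Finset.mem_coe.mpr (Finset.mem_filter.mpr ⟨hS, h2, h4⟩)))).trans
          Set.subset_union_right
    have v1 := volume_biUnion_normAvg_le hφ (𝓡 := 𝓡₁) (Q := Q)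
      (fun R hR => (Finset.mem_filter.mp hR).2.1) fun R hR => (Finset.mem_filter.mp hR).2.2
    have v2 := volume_biUnion_normAvg_le hψ (𝓡 := 𝓡₂) (Q := Q)
      (fun R hR => (Finset.mem_filter.mp hR).2.1) fun R hR => (Finset.mem_filter.mp hR).2.2
    have hfin : ∀ 𝓡 : Finset (DyadicCube d), volume (⋃ R ∈ 𝓡, R.toSet ω) ≠ ∞ := fun 𝓡 =>
      ((measure_biUnion_finset_le _ _).trans_lt
          (ENNReal.sum_lt_top.mpr fun R _ => (volume_ne_top R).lt_top)).ne
    have v3 : volume.real U ≤ volume.real (⋃ R ∈ 𝓡₁, R.toSet ω) +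
        volume.real (⋃ R ∈ 𝓡₂, R.toSet ω) :=
      (measureReal_mono hUsub (by simp [hfin])).trans (measureReal_union_le _ _)
    have v4 : volume.real (Q.toSet ω) ≤ volume.real (sparsePart ω 𝓢 Q) + volume.real U := by
      refine (measureReal_mono (s₂ := sparsePart ω 𝓢 Q ∪ U) ?_ ?_).trans
        (measureReal_union_le _ _)
      · rw [sparsePart, ← hU, Set.sdiff_union_self]; exact Set.subset_union_left
      · refine ne_of_lt ((measure_union_le _ _).trans_lt (ENNReal.add_lt_top.mpr ⟨?_, ?_⟩))
        · exact (measure_mono Set.sdiff_subset).trans_lt (volume_ne_top Q).lt_top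
        · exact (measure_mono hUsub).trans_lt (lt_top_iff_ne_top.mpr (by simp [hfin]))
    have v5 : volume.real (Q.toSet ω) ≤ 2 * volume.real (sparsePart ω 𝓢 Q) := by linarith
    have hfinE : volume (sparsePart ω 𝓢 Q) ≠ ∞ :=
      ((measure_mono Set.sdiff_subset).trans_lt (volume_ne_top Q).lt_top).ne
    rw [← ENNReal.toReal_le_toReal (volume_ne_top Q) (ENNReal.mul_ne_top (by simp) hfinE),
      ENNReal.toReal_mul]
    simpa [measureReal_def] using v5
  · rw [← Finset.sum_fiberwise_of_maps_to (t := 𝓢) (g := π) fun K hK => (hπ K (h𝒬𝒯 hK)).1,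
      Finset.mul_sum]
    refine norm_sum_le_of_le _ fun S hS => ?_
    -- A cube `R` between `K` and its principal cube `S` has the same principal cube, by minimality
    -- in both directions, so its averages are controlled by those of `S`.
    have hgood : ∀ K ∈ 𝒬.filter fun K => π K = S, ∀ R : DyadicCube d,
        K.toSet ω ⊆ R.toSet ω → R.toSet ω ⊆ S.toSet ω →
          normAvg ω φ R ≤ 4 * normAvg ω φ S ∧ normAvg ω ψ R ≤ 4 * normAvg ω ψ S := by
      intro K hK R hKR hRS
      obtain ⟨hK𝒬, rfl⟩ := Finset.mem_filter.mp hK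
      have hR : R ∈ 𝒯 := by
        obtain ⟨K', hK', hSK'⟩ := ((hmem _).mp (hS𝒯 hS)).1
        exact (hmem R).mpr ⟨⟨K', hK', hRS.trans hSK'⟩, K, hK𝒬, hKR⟩
      obtain ⟨h1, h2, h3, h4⟩ := hπ R hR
      have : π R = π K := eq_of_subset_of_subset (h4 _ hS hRS)
        ((hπ K (h𝒬𝒯 hK𝒬)).2.2.2 _ h1 (hKR.trans h2))
      rwa [this] at h3
    have hV := volume_real_pos (ω := ω) S
    -- The two thresholds contribute `4 * 4`, which with the local constant `4 * 8 ^ d` gives `64 *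
    -- 8 ^ d`.
    refine (norm_sum_avgForm_local ha hφ hψ S (s := 4 * normAvg ω φ S)
      (t := 4 * normAvg ω ψ S) ?_ ?_ ?_ ?_ ?_).trans (le_of_eq ?_)
    · intro K hK
      obtain ⟨hK𝒬, rfl⟩ := Finset.mem_filter.mp hK
      exact (hπ K (h𝒬𝒯 hK𝒬)).2.1
    · have := normAvg_nonneg (ω := ω) φ S; positivity
    · have := normAvg_nonneg (ω := ω) ψ S; positivity
    · intro K hK R h1 h2
      rw [← normAvg_mul]
      exact mul_le_mul_of_nonneg_right (hgood K hK R h1 h2).1 (volume_real_pos R).le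
    · intro K hK R h1 h2
      rw [← normAvg_mul]
      exact mul_le_mul_of_nonneg_right (hgood K hK R h1 h2).2 (volume_real_pos R).le
    · unfold normAvg
      field_simp
      ring

/-! ### Carleson embedding for principal cubes -/

/-- `𝓕 ⊆ 𝓢` is a family of principal cubes for the quantities `α`, and `π S` is the smallest cube
of `𝓕` that contains `S`. -/
structure IsPrincipal (ω : ℤ → Fin d → Fin 2) (𝓢 : Finset (DyadicCube d))
    (α : DyadicCube d → ℝ) (𝓕 : Finset (DyadicCube d)) (π : DyadicCube d → DyadicCube d) :
    Prop where
  subset : 𝓕 ⊆ 𝓢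
  mem : ∀ S ∈ 𝓢, π S ∈ 𝓕
  le : ∀ S ∈ 𝓢, S.toSet ω ⊆ (π S).toSet ω
  bound : ∀ S ∈ 𝓢, α S ≤ 2 * α (π S)
  minimal : ∀ S ∈ 𝓢, ∀ F ∈ 𝓕, S.toSet ω ⊆ F.toSet ω → (π S).toSet ω ⊆ F.toSet ω
  growth : ∀ F ∈ 𝓕, ∀ F' ∈ 𝓕, F.toSet ω ⊆ F'.toSet ω → F ≠ F' → 2 * α F' ≤ α F

lemma exists_isPrincipal [NeZero d] (ω : ℤ → Fin d → Fin 2) (𝓢 : Finset (DyadicCube d))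
    {α : DyadicCube d → ℝ} (hα : ∀ S, 0 ≤ α S) : ∃ 𝓕 π, IsPrincipal ω 𝓢 α 𝓕 π := by
  obtain ⟨𝓕, hsub, hprin, hchain⟩ := exists_principal ω 𝓢
    (good := fun R S => α R ≤ 2 * α S) fun R => by linarith [hα R]
  have hπ : ∀ R : DyadicCube d, ∃ P, R ∈ 𝓢 → P ∈ 𝓕 ∧ R.toSet ω ⊆ P.toSet ω ∧
      α R ≤ 2 * α P ∧ ∀ S ∈ 𝓕, R.toSet ω ⊆ S.toSet ω → P.toSet ω ⊆ S.toSet ω := by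
    intro R
    by_cases hR : R ∈ 𝓢
    · obtain ⟨P, hP⟩ := hprin R hR
      exact ⟨P, fun _ => hP⟩
    · exact ⟨R, fun h => absurd h hR⟩
  choose π hπ using hπ
  refine ⟨𝓕, π, hsub, fun S hS => (hπ S hS).1, fun S hS => (hπ S hS).2.1,
    fun S hS => (hπ S hS).2.2.1, fun S hS => (hπ S hS).2.2.2, ?_⟩
  -- The construction gives the doubling only from `F'` to some intermediate `S`. Induction on the
  -- gap of scales continues from `S` down to `F`, and nonnegativity of `α` keeps the factor two.
  have key : ∀ n : ℕ, ∀ F ∈ 𝓕, ∀ F' ∈ 𝓕, F.toSet ω ⊆ F'.toSet ω → F ≠ F' →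
      F.scale - F'.scale ≤ n → 2 * α F' ≤ α F := by
    intro n
    induction n with
    | zero =>
      intro F _ F' _ h hne hn
      have := scale_lt_of_subset_of_ne h hne
      simp only [Nat.cast_zero] at hn
      omega
    | succ n ih =>
      intro F hF F' hF' h hne hn
      obtain ⟨S, hS, h1, h2, h3, h4⟩ := hchain F hF F' hF' h hne
      rw [not_le] at h4
      by_cases hFS : F = S
      · rw [hFS]; exact h4.le
      · have := scale_lt_of_subset_of_ne h2 h3
        have := ih F hF S hS h1 hFS (by push_cast at hn; omega)
        linarith [hα S]
  intro F hF F' hF' h hne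
  exact key (F.scale - F'.scale).toNat F hF F' hF' h hne (Int.self_le_toNat _)

/-- The cubes through `x` form a chain along which `α` at least doubles, so the sum is geometric and
at most twice its term at the smallest cube. -/
lemma sum_sq_le_of_growth [NeZero d] {α : DyadicCube d → ℝ} (hα : ∀ S, 0 ≤ α S)
    {x : Fin d → ℝ} {𝓒 : Finset (DyadicCube d)} (hx : ∀ S ∈ 𝓒, x ∈ S.toSet ω)
    (hg : ∀ F ∈ 𝓒, ∀ F' ∈ 𝓒, F.toSet ω ⊆ F'.toSet ω → F ≠ F' → 2 * α F' ≤ α F) :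
    (∑ S ∈ 𝓒, α S) ^ 2 ≤ 4 * ∑ S ∈ 𝓒, α S ^ 2 := by
  classical
  have key : ∀ s : Finset (DyadicCube d), s ⊆ 𝓒 → s.Nonempty →
      ∃ R ∈ s, ∑ S ∈ s, α S ≤ 2 * α R := by
    intro s
    refine Finset.induction_on_max_value DyadicCube.scale s (fun _ h => ?_) ?_
    · exact absurd h (by simp)
    · intro R t hR hmax ih hsub _
      refine ⟨R, Finset.mem_insert_self _ _, ?_⟩
      rw [Finset.sum_insert hR]
      rcases t.eq_empty_or_nonempty with rfl | hne
      · simp only [Finset.sum_empty]; linarith [hα R]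
      · obtain ⟨P, hP, hle⟩ := ih ((Finset.subset_insert _ _).trans hsub) hne
        have hR𝓒 := hsub (Finset.mem_insert_self _ _)
        have hP𝓒 := hsub (Finset.mem_insert_of_mem hP)
        have := hg R hR𝓒 P hP𝓒 (subset_of_mem (hx P hP𝓒) (hx R hR𝓒) (hmax P hP))
          (fun h => hR (h ▸ hP))
        linarith
  rcases 𝓒.eq_empty_or_nonempty with rfl | hne
  · simp
  · obtain ⟨R, hR, hle⟩ := key 𝓒 subset_rfl hne
    have h1 : α R ^ 2 ≤ ∑ S ∈ 𝓒, α S ^ 2 :=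
      Finset.single_le_sum (f := fun S => α S ^ 2) (fun S _ => sq_nonneg (α S)) hR
    have h0 : 0 ≤ ∑ S ∈ 𝓒, α S := Finset.sum_nonneg fun S _ => hα S
    nlinarith

/-- The average of `f` over a cube with respect to the measure `ν`. -/
noncomputable def measureAvg (ω : ℤ → Fin d → Fin 2) (ν : Measure (Fin d → ℝ))
    (f : (Fin d → ℝ) → ℝ) (Q : DyadicCube d) : ℝ :=
  (∫ x in Q.toSet ω, f x ∂ν) / ν.real (Q.toSet ω)

lemma measureAvg_nonneg (ν : Measure (Fin d → ℝ)) {f : (Fin d → ℝ) → ℝ} (hf : ∀ x, 0 ≤ f x)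
    (Q : DyadicCube d) : 0 ≤ measureAvg ω ν f Q :=
  div_nonneg (integral_nonneg hf) measureReal_nonneg

lemma measureAvg_mul {ν : Measure (Fin d → ℝ)} (f : (Fin d → ℝ) → ℝ) {Q : DyadicCube d}
    (hν : ν (Q.toSet ω) ≠ ∞) :
    measureAvg ω ν f Q * ν.real (Q.toSet ω) = ∫ x in Q.toSet ω, f x ∂ν := by
  by_cases h : ν.real (Q.toSet ω) = 0
  · rw [h, mul_zero]
    rw [measureReal_eq_zero_iff hν] at h
    rw [Measure.restrict_eq_zero.mpr h, integral_zero_measure]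
  · exact div_mul_cancel₀ _ h

lemma integral_sum_indicator {ι : Type*} {ν : Measure (Fin d → ℝ)} {s : Finset ι}
    {A : ι → Set (Fin d → ℝ)} {f : ι → (Fin d → ℝ) → ℝ} (hA : ∀ S ∈ s, MeasurableSet (A S))
    (hf : ∀ S ∈ s, IntegrableOn (f S) (A S) ν) :
    Integrable (fun x => ∑ S ∈ s, (A S).indicator (f S) x) ν ∧
      ∫ x, ∑ S ∈ s, (A S).indicator (f S) x ∂ν = ∑ S ∈ s, ∫ x in A S, f S x ∂ν := by
  have hi : ∀ S ∈ s, Integrable (fun x => (A S).indicator (f S) x) ν := fun S hS =>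
    (integrable_indicator_iff (hA S hS)).mpr (hf S hS)
  refine ⟨integrable_finsetSum _ hi, ?_⟩
  rw [integral_finsetSum _ hi]
  exact Finset.sum_congr rfl fun S hS => integral_indicator (hA S hS)

/-- Carleson embedding by absorption instead of a maximal function. The left side `X` equals `∫ (∑
α_F 1_F) f dν`. With `a = ∑ α_F 1_F`, one has `a f ≤ 2f² + a²/8 ≤ 2f² + ½ ∑ α_F² 1_F`, whence `X ≤
2∫f² + X/2`, and `X` is finite. -/
lemma sum_measureAvg_sq_le [NeZero d] {ν : Measure (Fin d → ℝ)}
    (hν : ∀ Q : DyadicCube d, ν (Q.toSet ω) ≠ ∞) {f : (Fin d → ℝ) → ℝ} (hf : ∀ x, 0 ≤ f x)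
    (hfi : ∀ Q : DyadicCube d, IntegrableOn f (Q.toSet ω) ν)
    (hf2 : Integrable (fun x => f x ^ 2) ν) {𝓕 : Finset (DyadicCube d)}
    (hg : ∀ F ∈ 𝓕, ∀ F' ∈ 𝓕, F.toSet ω ⊆ F'.toSet ω → F ≠ F' →
      2 * measureAvg ω ν f F' ≤ measureAvg ω ν f F) :
    ∑ F ∈ 𝓕, measureAvg ω ν f F ^ 2 * ν.real (F.toSet ω) ≤ 4 * ∫ x, f x ^ 2 ∂ν := by
  classical
  set α := measureAvg ω ν f with hα
  have hα0 : ∀ S, 0 ≤ α S := measureAvg_nonneg ν hf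
  obtain ⟨i1, e1⟩ := integral_sum_indicator (ν := ν) (s := 𝓕) (A := DyadicCube.toSet ω)
    (f := fun F x => α F * f x) (fun S _ => measurableSet_toSet S)
    fun S _ => (hfi S).const_mul _
  obtain ⟨i2, e2⟩ := integral_sum_indicator (ν := ν) (s := 𝓕) (A := DyadicCube.toSet ω)
    (f := fun F _ => α F ^ 2) (fun S _ => measurableSet_toSet S)
    fun S _ => integrableOn_const (hν S)
  have hX1 : ∑ F ∈ 𝓕, α F ^ 2 * ν.real (F.toSet ω) =
      ∫ x, ∑ F ∈ 𝓕, (F.toSet ω).indicator (fun x => α F * f x) x ∂ν := by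
    rw [e1]
    refine Finset.sum_congr rfl fun F _ => ?_
    rw [integral_const_mul, ← measureAvg_mul f (hν F)]
    ring
  have hX2 : ∑ F ∈ 𝓕, α F ^ 2 * ν.real (F.toSet ω) =
      ∫ x, ∑ F ∈ 𝓕, (F.toSet ω).indicator (fun _ => α F ^ 2) x ∂ν := by
    rw [e2]
    refine Finset.sum_congr rfl fun F _ => ?_
    rw [setIntegral_const, smul_eq_mul, mul_comm]
  have hpt : ∀ x, ∑ F ∈ 𝓕, (F.toSet ω).indicator (fun x => α F * f x) x ≤
      2 * f x ^ 2 + 2⁻¹ * ∑ F ∈ 𝓕, (F.toSet ω).indicator (fun _ => α F ^ 2) x := by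
    intro x
    rw [Finset.sum_indicator_eq_sum_filter 𝓕 (fun F x => α F * f x) (DyadicCube.toSet ω)
      (fun _ => x), Finset.sum_indicator_eq_sum_filter 𝓕 (fun F _ => α F ^ 2)
      (DyadicCube.toSet ω) (fun _ => x), ← Finset.sum_mul]
    have := sum_sq_le_of_growth (ω := ω) hα0 (x := x)
      (𝓒 := 𝓕.filter fun F => x ∈ F.toSet ω) (fun S hS => (Finset.mem_filter.mp hS).2)
      fun F hF F' hF' => hg F (Finset.mem_filter.mp hF).1 F' (Finset.mem_filter.mp hF').1
    nlinarith [sq_nonneg ((∑ F ∈ 𝓕 with x ∈ F.toSet ω, α F) - 4 * f x)]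
  have hint := integral_mono i1 ((hf2.const_mul 2).add (i2.const_mul 2⁻¹)) hpt
  simp only [Pi.add_apply] at hint
  rw [integral_add (hf2.const_mul 2) (i2.const_mul 2⁻¹), integral_const_mul,
    integral_const_mul, ← hX1, ← hX2] at hint
  linarith

/-! ### The testing estimate -/

/-- After expanding the square only nested pairs remain. For a fixed outer cube `S`, joint `A_2`
turns `∑ c_{S'} μ(S')` over `S' ⊆ S` into `A ∑ |S'|`, sparseness bounds this by `2A|S|`, and `c_S|S|
= ν(S)`. Either cube of a pair may be the outer one, which gives the other factor two. -/
lemma integral_sq_sum_indicator_le {𝓢 𝓣 : Finset (DyadicCube d)} (h𝓢 : IsSparse ω 𝓢)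
    (h𝓣 : 𝓣 ⊆ 𝓢) {μ ν : Measure (Fin d → ℝ)} (hμ : ∀ Q : DyadicCube d, μ (Q.toSet ω) ≠ ∞)
    {A : ℝ} (hA : ∀ Q : DyadicCube d, μ.real (Q.toSet ω) * ν.real (Q.toSet ω) ≤
      A * volume.real (Q.toSet ω) ^ 2) :
    Integrable (fun x => (∑ S ∈ 𝓣, (S.toSet ω).indicator
      (fun _ => ν.real (S.toSet ω) / volume.real (S.toSet ω)) x) ^ 2) μ ∧
    ∫ x, (∑ S ∈ 𝓣, (S.toSet ω).indicator
      (fun _ => ν.real (S.toSet ω) / volume.real (S.toSet ω)) x) ^ 2 ∂μ ≤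
      4 * A * ∑ S ∈ 𝓣, ν.real (S.toSet ω) := by
  classical
  set c : DyadicCube d → ℝ := fun S => ν.real (S.toSet ω) / volume.real (S.toSet ω) with hc
  have hc0 : ∀ S, 0 ≤ c S := fun S => div_nonneg measureReal_nonneg measureReal_nonneg
  have hsq : ∀ x, (∑ S ∈ 𝓣, (S.toSet ω).indicator (fun _ => c S) x) ^ 2 =
      ∑ p ∈ 𝓣 ×ˢ 𝓣, (p.1.toSet ω ∩ p.2.toSet ω).indicator (fun _ => c p.1 * c p.2) x := by
    intro x
    rw [sq, Finset.sum_mul_sum, ← Finset.sum_product']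
    refine Finset.sum_congr rfl fun p _ => ?_
    rw [Set.inter_indicator_mul]
  obtain ⟨i1, e1⟩ := integral_sum_indicator (ν := μ) (s := 𝓣 ×ˢ 𝓣)
    (A := fun p => p.1.toSet ω ∩ p.2.toSet ω) (f := fun p _ => c p.1 * c p.2)
    (fun p _ => (measurableSet_toSet p.1).inter (measurableSet_toSet p.2))
    fun p _ => integrableOn_const (((measure_mono Set.inter_subset_left).trans_lt
      (hμ p.1).lt_top).ne)
  change Integrable (fun x => (∑ S ∈ 𝓣, (S.toSet ω).indicator (fun _ => c S) x) ^ 2) μ ∧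
    ∫ x, (∑ S ∈ 𝓣, (S.toSet ω).indicator (fun _ => c S) x) ^ 2 ∂μ ≤ _
  simp only [hsq]
  refine ⟨i1, ?_⟩
  rw [e1, Finset.sum_product' (f := fun S S' => ∫ _ in S.toSet ω ∩ S'.toSet ω, c S * c S' ∂μ)]
  have hA0 : 0 ≤ A := by
    by_contra hneg
    have hQ := hA ⟨0, 0⟩
    have : 0 < volume.real (DyadicCube.toSet ω (⟨0, 0⟩ : DyadicCube d)) := volume_real_pos _
    have h1 : 0 ≤ μ.real (DyadicCube.toSet ω (⟨0, 0⟩ : DyadicCube d)) *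
      ν.real (DyadicCube.toSet ω (⟨0, 0⟩ : DyadicCube d)) := by positivity
    push Not at hneg
    have := mul_neg_of_neg_of_pos hneg (pow_pos this 2)
    linarith
  let D : DyadicCube d → DyadicCube d → ℝ := fun S S' =>
    if S'.toSet ω ⊆ S.toSet ω then c S * (c S' * μ.real (S'.toSet ω)) else 0
  have hD0 : ∀ S S', 0 ≤ D S S' := fun S S' => by
    simp only [D]
    split_ifs
    · exact mul_nonneg (hc0 _) (mul_nonneg (hc0 _) measureReal_nonneg)
    · exact le_rfl
  have hpair : ∀ S S', ∫ _ in S.toSet ω ∩ S'.toSet ω, c S * c S' ∂μ ≤ D S S' + D S' S := by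
    intro S S'
    rw [setIntegral_const, smul_eq_mul]
    by_cases hemp : S.toSet ω ∩ S'.toSet ω = ∅
    · rw [hemp, measureReal_empty, zero_mul]
      exact add_nonneg (hD0 _ _) (hD0 _ _)
    · obtain ⟨x, hx, hx'⟩ := Set.nonempty_iff_ne_empty.mpr hemp
      rcases subset_or_subset hx hx' with h | h
      · have : D S S' = c S * (c S' * μ.real (S'.toSet ω)) := by simp only [D, if_pos h]
        rw [Set.inter_eq_right.mpr h]
        linarith [hD0 S' S]
      · have : D S' S = c S' * (c S * μ.real (S.toSet ω)) := by simp only [D, if_pos h]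
        rw [Set.inter_eq_left.mpr h]
        linarith [hD0 S S']
  have hrow : ∀ S ∈ 𝓣, ∑ S' ∈ 𝓣, D S S' ≤ 2 * A * ν.real (S.toSet ω) := by
    intro S _
    have hS := volume_real_pos (ω := ω) S
    simp only [D]
    rw [← Finset.sum_filter, ← Finset.mul_sum]
    have h1 : ∑ S' ∈ 𝓣 with S'.toSet ω ⊆ S.toSet ω, c S' * μ.real (S'.toSet ω) ≤
        ∑ S' ∈ 𝓣 with S'.toSet ω ⊆ S.toSet ω, A * volume.real (S'.toSet ω) := by
      refine Finset.sum_le_sum fun S' _ => ?_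
      have hS' := volume_real_pos (ω := ω) S'
      simp only [hc]
      rw [div_mul_eq_mul_div, div_le_iff₀ hS']
      have := hA S'
      nlinarith
    have h2 : ∑ S' ∈ 𝓣 with S'.toSet ω ⊆ S.toSet ω, volume.real (S'.toSet ω) ≤
        2 * volume.real (S.toSet ω) := by
      have := h𝓢.sum_mul_volume_le (𝓣 := 𝓣.filter fun S' => S'.toSet ω ⊆ S.toSet ω)
        ((Finset.filter_subset _ _).trans h𝓣) (F := S)
        (fun S' hS' => (Finset.mem_filter.mp hS').2) (c := fun _ => 1) (g := fun _ => 1)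
        fun _ _ _ _ => le_rfl
      simp only [one_mul, lintegral_one, Measure.restrict_apply_univ] at this
      have h3 := ENNReal.toReal_mono (ENNReal.mul_ne_top (by simp) (volume_ne_top S)) this
      rw [ENNReal.toReal_sum fun S' _ => volume_ne_top S', ENNReal.toReal_mul] at h3
      simpa [measureReal_def] using h3
    calc _ ≤ c S * (A * (2 * volume.real (S.toSet ω))) := by
          refine mul_le_mul_of_nonneg_left (h1.trans ?_) (hc0 S)
          rw [← Finset.mul_sum]
          exact mul_le_mul_of_nonneg_left h2 hA0
      _ = _ := by simp only [hc]; field_simp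
  calc ∑ S ∈ 𝓣, ∑ S' ∈ 𝓣, ∫ _ in S.toSet ω ∩ S'.toSet ω, c S * c S' ∂μ
      ≤ ∑ S ∈ 𝓣, ∑ S' ∈ 𝓣, (D S S' + D S' S) :=
        Finset.sum_le_sum fun S _ => Finset.sum_le_sum fun S' _ => hpair S S'
    _ = 2 * ∑ S ∈ 𝓣, ∑ S' ∈ 𝓣, D S S' := by
        simp only [Finset.sum_add_distrib]
        rw [Finset.sum_comm (f := fun S S' => D S' S)]
        ring
    _ ≤ 2 * ∑ S ∈ 𝓣, 2 * A * ν.real (S.toSet ω) := by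
        gcongr with S hS
        exact hrow S hS
    _ = _ := by rw [← Finset.mul_sum]; ring

/-! ### The two-weight bound for sparse forms -/

/-- Optimizing over `ε` recovers Cauchy–Schwarz, so that a sum of integrals can be estimated through
a pointwise arithmetic–geometric mean inequality. -/
lemma le_sqrt_mul_sqrt {L X Y : ℝ} (hX : 0 ≤ X) (hY : 0 ≤ Y)
    (h : ∀ ε > 0, 2 * L ≤ ε * X + ε⁻¹ * Y) : L ≤ √X * √Y := by
  have hx := Real.sqrt_nonneg X
  have hy := Real.sqrt_nonneg Y
  have hxx := Real.mul_self_sqrt hX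
  have hyy := Real.mul_self_sqrt hY
  refine le_of_forall_pos_le_add fun δ hδ => ?_
  -- The optimal `ε = √Y / √X` is perturbed by `γ`, since `X` or `Y` may vanish; the perturbation
  -- costs at most `δ`.
  set γ := δ / (√X + √Y + 1) with hγ
  have hγ0 : 0 < γ := by positivity
  have h1 := h ((√Y + γ) / (√X + γ)) (by positivity)
  have e1 : (√Y + γ) / (√X + γ) * X ≤ (√Y + γ) * √X := by
    rw [div_mul_eq_mul_div, div_le_iff₀ (by positivity)]
    nlinarith [mul_nonneg (mul_nonneg (add_nonneg hy hγ0.le) hx) hγ0.le]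
  have e2 : ((√Y + γ) / (√X + γ))⁻¹ * Y ≤ (√X + γ) * √Y := by
    rw [inv_div, div_mul_eq_mul_div, div_le_iff₀ (by positivity)]
    nlinarith [mul_nonneg (mul_nonneg (add_nonneg hx hγ0.le) hy) hγ0.le]
  have e3 : γ * (√X + √Y) ≤ δ := by
    rw [hγ, div_mul_eq_mul_div, div_le_iff₀ (by positivity)]
    nlinarith
  nlinarith

/-- The sum is grouped by `F = π S`. When `ρ S ⊆ π S`, the cube `ρ S` lies in the same corona, so `β
(ρ S) ≤ √H_F` on `S`, where `H_F` sums `β_G² 1_G` over the `G` with `π G = F`. What remains is `α_F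
√H_F T_F`, with `T_F` controlled in `L²(μ)` by testing. Each `G` belongs to exactly one corona, so
the `H_F` add up to the last factor. -/
lemma sum_corona_le [NeZero d] {𝓢 : Finset (DyadicCube d)} (h𝓢 : IsSparse ω 𝓢)
    {μ ν : Measure (Fin d → ℝ)} (hμ : ∀ Q : DyadicCube d, μ (Q.toSet ω) ≠ ∞)
    {A B : ℝ} (hA0 : 0 ≤ A) (hA : ∀ Q : DyadicCube d, μ.real (Q.toSet ω) * ν.real (Q.toSet ω) ≤
      A * volume.real (Q.toSet ω) ^ 2)
    (hB : ∀ (F : DyadicCube d) (𝓣 : Finset (DyadicCube d)), 𝓣 ⊆ 𝓢 →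
      (∀ S ∈ 𝓣, S.toSet ω ⊆ F.toSet ω) →
      ∑ S ∈ 𝓣, ν.real (S.toSet ω) ≤ 2 * B * ν.real (F.toSet ω))
    {α β : DyadicCube d → ℝ} (hα : ∀ S, 0 ≤ α S)
    {𝓕 𝓖 𝓣 : Finset (DyadicCube d)} {π ρ : DyadicCube d → DyadicCube d}
    (hF : IsPrincipal ω 𝓢 α 𝓕 π) (hG : IsPrincipal ω 𝓢 β 𝓖 ρ) (h𝓣 : 𝓣 ⊆ 𝓢)
    (hle : ∀ S ∈ 𝓣, (ρ S).toSet ω ⊆ (π S).toSet ω) :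
    ∑ S ∈ 𝓣, α (π S) * β (ρ S) * (ν.real (S.toSet ω) * μ.real (S.toSet ω) /
      volume.real (S.toSet ω)) ≤
      √(8 * A * B * ∑ F ∈ 𝓕, α F ^ 2 * ν.real (F.toSet ω)) *
        √(∑ G ∈ 𝓖, β G ^ 2 * μ.real (G.toSet ω)) := by
  classical
  set c : DyadicCube d → ℝ := fun S => ν.real (S.toSet ω) / volume.real (S.toSet ω) with hc
  have hc0 : ∀ S, 0 ≤ c S := fun S => div_nonneg measureReal_nonneg measureReal_nonneg
  let 𝓤 : DyadicCube d → Finset (DyadicCube d) := fun F => 𝓢.filter fun S => π S = F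
  have h𝓤sub : ∀ F, 𝓤 F ⊆ 𝓢 := fun F => Finset.filter_subset _ _
  let T : DyadicCube d → (Fin d → ℝ) → ℝ := fun F x =>
    ∑ S ∈ 𝓤 F, (S.toSet ω).indicator (fun _ => c S) x
  have hT : ∀ F, Integrable (fun x => T F x ^ 2) μ ∧
      ∫ x, T F x ^ 2 ∂μ ≤ 8 * A * B * ν.real (F.toSet ω) := by
    intro F
    obtain ⟨h1, h2⟩ := integral_sq_sum_indicator_le h𝓢 (h𝓤sub F) hμ hA
    refine ⟨h1, h2.trans ?_⟩
    have h3 := hB F (𝓤 F) (h𝓤sub F) fun S hS => by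
      obtain ⟨hS, rfl⟩ := Finset.mem_filter.mp hS
      exact hF.le S (by assumption)
    calc 4 * A * ∑ S ∈ 𝓤 F, ν.real (S.toSet ω) ≤ 4 * A * (2 * B * ν.real (F.toSet ω)) := by
          gcongr
      _ = _ := by ring
  -- The sign of `B` is not assumed; each term is nonnegative because it dominates the integral of a
  -- square.
  have hX0 : 0 ≤ 8 * A * B * ∑ F ∈ 𝓕, α F ^ 2 * ν.real (F.toSet ω) := by
    rw [Finset.mul_sum]
    refine Finset.sum_nonneg fun F _ => ?_
    have := (integral_nonneg (μ := μ) fun x => sq_nonneg (T F x)).trans (hT F).2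
    nlinarith [sq_nonneg (α F)]
  refine le_sqrt_mul_sqrt hX0
    (Finset.sum_nonneg fun G _ => mul_nonneg (sq_nonneg _) measureReal_nonneg) fun ε hε => ?_
  obtain ⟨i1, e1⟩ := integral_sum_indicator (ν := μ) (s := 𝓣) (A := DyadicCube.toSet ω)
    (f := fun S _ => α (π S) * β (ρ S) * c S) (fun S _ => measurableSet_toSet S)
    fun S _ => integrableOn_const (hμ S)
  obtain ⟨i2, e2⟩ := integral_sum_indicator (ν := μ) (s := 𝓖) (A := DyadicCube.toSet ω)
    (f := fun G _ => β G ^ 2) (fun S _ => measurableSet_toSet S)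
    fun S _ => integrableOn_const (hμ S)
  have hL : ∑ S ∈ 𝓣, α (π S) * β (ρ S) * (ν.real (S.toSet ω) * μ.real (S.toSet ω) /
      volume.real (S.toSet ω)) =
      ∫ x, ∑ S ∈ 𝓣, (S.toSet ω).indicator (fun _ => α (π S) * β (ρ S) * c S) x ∂μ := by
    rw [e1]
    refine Finset.sum_congr rfl fun S _ => ?_
    rw [setIntegral_const, smul_eq_mul]
    simp only [hc]; ring
  have hY : ∑ G ∈ 𝓖, β G ^ 2 * μ.real (G.toSet ω) =
      ∫ x, ∑ G ∈ 𝓖, (G.toSet ω).indicator (fun _ => β G ^ 2) x ∂μ := by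
    rw [e2]
    refine Finset.sum_congr rfl fun S _ => ?_
    rw [setIntegral_const, smul_eq_mul, mul_comm]
  have i3 : Integrable (fun x => ∑ F ∈ 𝓕, α F ^ 2 * T F x ^ 2) μ :=
    integrable_finsetSum _ fun F _ => (hT F).1.const_mul _
  have hX : ∫ x, ∑ F ∈ 𝓕, α F ^ 2 * T F x ^ 2 ∂μ ≤
      8 * A * B * ∑ F ∈ 𝓕, α F ^ 2 * ν.real (F.toSet ω) := by
    rw [integral_finsetSum _ fun F _ => (hT F).1.const_mul _, Finset.mul_sum]
    refine Finset.sum_le_sum fun F _ => ?_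
    rw [integral_const_mul]
    calc _ ≤ α F ^ 2 * (8 * A * B * ν.real (F.toSet ω)) :=
          mul_le_mul_of_nonneg_left (hT F).2 (sq_nonneg _)
      _ = _ := by ring
  have hpt : ∀ x, 2 * ∑ S ∈ 𝓣, (S.toSet ω).indicator (fun _ => α (π S) * β (ρ S) * c S) x ≤
      ε * (∑ F ∈ 𝓕, α F ^ 2 * T F x ^ 2) +
        ε⁻¹ * ∑ G ∈ 𝓖, (G.toSet ω).indicator (fun _ => β G ^ 2) x := by
    intro x
    have hfibL := Finset.sum_fiberwise_of_maps_to (s := 𝓣) (t := 𝓕) (g := π)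
      (fun S hS => hF.mem S (h𝓣 hS))
      fun S => (S.toSet ω).indicator (fun _ => α (π S) * β (ρ S) * c S) x
    have hfibG := Finset.sum_fiberwise_of_maps_to (s := 𝓖) (t := 𝓕) (g := π)
      (fun S hS => hF.mem S (hG.subset hS))
      fun G => (G.toSet ω).indicator (fun _ => β G ^ 2) x
    rw [← hfibL, ← hfibG]
    simp only [Finset.mul_sum (s := 𝓕)]
    rw [← Finset.sum_add_distrib]
    refine Finset.sum_le_sum fun F _ => ?_
    set H := ∑ G ∈ 𝓖 with π G = F, (G.toSet ω).indicator (fun _ => β G ^ 2) x with hH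
    have hH0 : 0 ≤ H := Finset.sum_nonneg fun G _ =>
      Set.indicator_nonneg (fun _ _ => sq_nonneg _) x
    have hT0 : 0 ≤ T F x := Finset.sum_nonneg fun S _ =>
      Set.indicator_nonneg (fun _ _ => hc0 S) x
    have h1 : ∑ S ∈ 𝓣 with π S = F, (S.toSet ω).indicator
        (fun _ => α (π S) * β (ρ S) * c S) x ≤ α F * √H * T F x := by
      calc _ ≤ ∑ S ∈ 𝓣 with π S = F, α F * √H * (S.toSet ω).indicator (fun _ => c S) x := by
            refine Finset.sum_le_sum fun S hS => ?_
            obtain ⟨hS𝓣, hSF⟩ := Finset.mem_filter.mp hS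
            by_cases hx : x ∈ S.toSet ω
            · rw [Set.indicator_of_mem hx, Set.indicator_of_mem hx, hSF]
              have hS𝓢 := h𝓣 hS𝓣
              have hρ := hG.mem S hS𝓢
              have hSρ := hG.le S hS𝓢
              -- One inclusion holds because `F` contains `ρ S`, the other because `π (ρ S)`
              -- contains `S`.
              have hπρ : π (ρ S) = F := by
                rw [← hSF]
                refine eq_of_subset_of_subset
                  (hF.minimal _ (hG.subset hρ) _ (hF.mem S hS𝓢) (hle S hS𝓣))
                  (hF.minimal S hS𝓢 _ (hF.mem _ (hG.subset hρ))
                    (hSρ.trans (hF.le _ (hG.subset hρ))))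
              have hβH : β (ρ S) ≤ √H := by
                refine Real.le_sqrt_of_sq_le ?_
                have := Finset.single_le_sum
                  (f := fun G => (G.toSet ω).indicator (fun _ => β G ^ 2) x)
                  (s := 𝓖.filter fun G => π G = F)
                  (fun G _ => Set.indicator_nonneg (fun _ _ => sq_nonneg _) x)
                  (Finset.mem_filter.mpr ⟨hρ, hπρ⟩)
                rwa [Set.indicator_of_mem (hSρ hx)] at this
              have := hα F
              have := hc0 S
              gcongr
            · rw [Set.indicator_of_notMem hx, Set.indicator_of_notMem hx, mul_zero]
        _ ≤ _ := by
            rw [← Finset.mul_sum]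
            refine mul_le_mul_of_nonneg_left ?_ (mul_nonneg (hα F) (Real.sqrt_nonneg _))
            exact Finset.sum_le_sum_of_subset_of_nonneg (Finset.filter_subset_filter _ h𝓣)
              fun S _ _ => Set.indicator_nonneg (fun _ _ => hc0 S) x
    have h2 : 2 * (α F * √H * T F x) ≤ ε * (α F ^ 2 * T F x ^ 2) + ε⁻¹ * H := by
      have hHH := Real.sq_sqrt hH0
      have hid : ε * (α F ^ 2 * T F x ^ 2) + ε⁻¹ * H - 2 * (α F * √H * T F x) =
          ε⁻¹ * (ε * (α F * T F x) - √H) ^ 2 := by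
        rw [← hHH, Real.sqrt_sq (Real.sqrt_nonneg _)]
        field_simp
        ring
      have : 0 ≤ ε⁻¹ * (ε * (α F * T F x) - √H) ^ 2 := by positivity
      linarith
    linarith
  have hint := integral_mono (i1.const_mul 2) ((i3.const_mul ε).add (i2.const_mul ε⁻¹)) hpt
  simp only [Pi.add_apply] at hint
  rw [integral_add (i3.const_mul ε) (i2.const_mul ε⁻¹)] at hint
  simp only [integral_const_mul] at hint
  rw [← hL, ← hY] at hint
  refine hint.trans ?_
  gcongr

/-- The cubes `π S` and `ρ S` both contain `S`, hence are nested, and the two orders are the same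
corona estimate with `μ` and `ν` exchanged; this is why the two packing constants appear as a sum.
In `48 = 4 * 12`, the `4` comes from replacing both averages by principal ones, and `12 ≥ √128` from
the testing constant `8` and the two embedding constants `4`. -/
lemma sum_sparse_le [NeZero d] {𝓢 : Finset (DyadicCube d)} (h𝓢 : IsSparse ω 𝓢)
    {μ ν : Measure (Fin d → ℝ)} (hμ : ∀ Q : DyadicCube d, μ (Q.toSet ω) ≠ ∞)
    (hν : ∀ Q : DyadicCube d, ν (Q.toSet ω) ≠ ∞)
    {A Bμ Bν : ℝ} (hA0 : 0 ≤ A) (hBμ0 : 0 ≤ Bμ) (hBν0 : 0 ≤ Bν)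
    (hA : ∀ Q : DyadicCube d, μ.real (Q.toSet ω) * ν.real (Q.toSet ω) ≤
      A * volume.real (Q.toSet ω) ^ 2)
    (hBμ : ∀ (F : DyadicCube d) (𝓣 : Finset (DyadicCube d)), 𝓣 ⊆ 𝓢 →
      (∀ S ∈ 𝓣, S.toSet ω ⊆ F.toSet ω) →
      ∑ S ∈ 𝓣, μ.real (S.toSet ω) ≤ 2 * Bμ * μ.real (F.toSet ω))
    (hBν : ∀ (F : DyadicCube d) (𝓣 : Finset (DyadicCube d)), 𝓣 ⊆ 𝓢 →
      (∀ S ∈ 𝓣, S.toSet ω ⊆ F.toSet ω) →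
      ∑ S ∈ 𝓣, ν.real (S.toSet ω) ≤ 2 * Bν * ν.real (F.toSet ω))
    {f g : (Fin d → ℝ) → ℝ} (hf : ∀ x, 0 ≤ f x) (hg : ∀ x, 0 ≤ g x)
    (hfi : ∀ Q : DyadicCube d, IntegrableOn f (Q.toSet ω) ν)
    (hgi : ∀ Q : DyadicCube d, IntegrableOn g (Q.toSet ω) μ)
    (hf2 : Integrable (fun x => f x ^ 2) ν) (hg2 : Integrable (fun x => g x ^ 2) μ) :
    ∑ S ∈ 𝓢, (∫ x in S.toSet ω, f x ∂ν) * (∫ x in S.toSet ω, g x ∂μ) /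
      volume.real (S.toSet ω) ≤
      48 * √A * (√Bμ + √Bν) * (√(∫ x, f x ^ 2 ∂ν) * √(∫ x, g x ^ 2 ∂μ)) := by
  classical
  set α := measureAvg ω ν f with hα
  set β := measureAvg ω μ g with hβ
  have hα0 : ∀ S, 0 ≤ α S := measureAvg_nonneg ν hf
  have hβ0 : ∀ S, 0 ≤ β S := measureAvg_nonneg μ hg
  obtain ⟨𝓕, π, hF⟩ := exists_isPrincipal ω 𝓢 hα0
  obtain ⟨𝓖, ρ, hG⟩ := exists_isPrincipal ω 𝓢 hβ0
  have hXf := sum_measureAvg_sq_le hν hf hfi hf2 hF.growth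
  have hXg := sum_measureAvg_sq_le hμ hg hgi hg2 hG.growth
  have hIf : 0 ≤ ∫ x, f x ^ 2 ∂ν := integral_nonneg fun _ => sq_nonneg _
  have hIg : 0 ≤ ∫ x, g x ^ 2 ∂μ := integral_nonneg fun _ => sq_nonneg _
  have h1 := sum_corona_le h𝓢 hμ hA0 hA hBν hα0 hF hG
    (Finset.filter_subset (fun S => (ρ S).toSet ω ⊆ (π S).toSet ω) 𝓢)
    fun S hS => (Finset.mem_filter.mp hS).2
  have h2 := sum_corona_le h𝓢 hν hA0 (fun Q => by rw [mul_comm]; exact hA Q) hBμ hβ0 hG hF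
    (Finset.filter_subset (fun S => (π S).toSet ω ⊆ (ρ S).toSet ω) 𝓢)
    fun S hS => (Finset.mem_filter.mp hS).2
  have hbd : ∀ {B X Y I J : ℝ}, 0 ≤ B → 0 ≤ I → X ≤ 4 * I → Y ≤ 4 * J →
      √(8 * A * B * X) * √Y ≤ 12 * √A * √B * (√I * √J) := by
    intro B X Y I J hB hI hX hY
    calc √(8 * A * B * X) * √Y ≤ √(8 * A * B * (4 * I)) * √(4 * J) := by gcongr
      _ = √(128 * (A * B * I)) * √J := by
          rw [Real.sqrt_mul (by norm_num : (0 : ℝ) ≤ 4), ← mul_assoc,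
            ← Real.sqrt_mul (by positivity)]
          congr 2; ring
      _ ≤ √(12 ^ 2 * (A * B * I)) * √J := by
          gcongr; norm_num
      _ = _ := by
          rw [Real.sqrt_mul (by norm_num), Real.sqrt_sq (by norm_num), Real.sqrt_mul
            (by positivity), Real.sqrt_mul hA0]
          ring
  have h1' := h1.trans (hbd hBν0 hIf hXf hXg)
  have h2' := h2.trans (hbd hBμ0 hIg hXg hXf)
  set l : DyadicCube d → ℝ := fun S => α (π S) * β (ρ S) *
    (ν.real (S.toSet ω) * μ.real (S.toSet ω) / volume.real (S.toSet ω)) with hl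
  have hl0 : ∀ S, 0 ≤ l S := fun S => by
    have := hα0 (π S)
    have := hβ0 (ρ S)
    simp only [hl]; positivity
  have h2'' : ∑ S ∈ 𝓢 with (π S).toSet ω ⊆ (ρ S).toSet ω, l S ≤
      12 * √A * √Bμ * (√(∫ x, g x ^ 2 ∂μ) * √(∫ x, f x ^ 2 ∂ν)) := by
    refine le_trans (le_of_eq ?_) h2'
    refine Finset.sum_congr rfl fun S _ => ?_
    simp only [hl]; ring
  have hsplit : ∑ S ∈ 𝓢, l S ≤ ∑ S ∈ 𝓢 with (ρ S).toSet ω ⊆ (π S).toSet ω, l S +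
      ∑ S ∈ 𝓢 with (π S).toSet ω ⊆ (ρ S).toSet ω, l S := by
    rw [Finset.sum_filter, Finset.sum_filter, ← Finset.sum_add_distrib]
    refine Finset.sum_le_sum fun S hS => ?_
    have := hl0 S
    rcases subset_or_subset_of_subset (hF.le S hS) (hG.le S hS) with h | h
    · rw [if_pos h]; split_ifs <;> linarith
    · rw [if_pos h]; split_ifs <;> linarith
  have hterm : ∑ S ∈ 𝓢, (∫ x in S.toSet ω, f x ∂ν) * (∫ x in S.toSet ω, g x ∂μ) /
      volume.real (S.toSet ω) ≤ 4 * ∑ S ∈ 𝓢, l S := by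
    rw [Finset.mul_sum]
    refine Finset.sum_le_sum fun S hS => ?_
    rw [← measureAvg_mul f (hν S), ← measureAvg_mul g (hμ S)]
    have e1 := hF.bound S hS
    have e2 := hG.bound S hS
    calc _ = α S * β S * (ν.real (S.toSet ω) * μ.real (S.toSet ω) /
          volume.real (S.toSet ω)) := by rw [← hα, ← hβ]; ring
      _ ≤ (2 * α (π S)) * (2 * β (ρ S)) * (ν.real (S.toSet ω) * μ.real (S.toSet ω) /
          volume.real (S.toSet ω)) := by
          have := hα0 S
          have := hβ0 S
          have := hα0 (π S)
          gcongr
      _ = _ := by simp only [hl]; ring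
  refine hterm.trans ?_
  have := hsplit.trans (add_le_add h1' h2'')
  calc _ ≤ 4 * (12 * √A * √Bν * (√(∫ x, f x ^ 2 ∂ν) * √(∫ x, g x ^ 2 ∂μ)) +
        12 * √A * √Bμ * (√(∫ x, g x ^ 2 ∂μ) * √(∫ x, f x ^ 2 ∂ν))) := by gcongr
    _ = _ := by ring

/-! ### Weights -/

lemma IsWeight.aemeasurable {w : (Fin d → ℝ) → ℝ} (hw : IsWeight w) :
    AEMeasurable (fun x => ENNReal.ofReal (w x)) volume :=
  hw.locallyIntegrable.aestronglyMeasurable.aemeasurable.ennreal_ofReal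

lemma IsWeight.toReal_ofReal {w : (Fin d → ℝ) → ℝ} (hw : IsWeight w) (x : Fin d → ℝ) :
    (ENNReal.ofReal (w x)).toReal = w x := ENNReal.toReal_ofReal (hw.nonneg x)

lemma IsWeight.measure_ne_top {w : (Fin d → ℝ) → ℝ} (hw : IsWeight w) (Q : DyadicCube d) :
    weightMeasure w (Q.toSet ω) ≠ ∞ := by
  have hsub : Q.toSet ω ⊆ Set.Icc (Q.corner ω) (fun r => Q.corner ω r + Q.sideLength) :=
    fun x hx => ⟨fun r => (hx r).1, fun r => (hx r).2.le⟩
  have hi : IntegrableOn w (Q.toSet ω) :=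
    (hw.locallyIntegrable.integrableOn_isCompact isCompact_Icc).mono_set hsub
  rw [weightMeasure, withDensity_apply _ (measurableSet_toSet Q)]
  exact hi.lintegral_lt_top.ne

lemma IsWeight.integrableOn_iff {w : (Fin d → ℝ) → ℝ} (hw : IsWeight w) {s : Set (Fin d → ℝ)}
    (hs : MeasurableSet s) {g : (Fin d → ℝ) → ℂ} :
    IntegrableOn g s (weightMeasure w) ↔ IntegrableOn (fun x => (w x : ℂ) * g x) s := by
  unfold IntegrableOn weightMeasure
  rw [restrict_withDensity hs, integrable_withDensity_iff_integrable_smul₀' hw.aemeasurable.restrict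
    (ae_of_all _ fun _ => ENNReal.ofReal_lt_top)]
  simp only [hw.toReal_ofReal, Complex.real_smul]

lemma IsWeight.setIntegral_norm {w : (Fin d → ℝ) → ℝ} (hw : IsWeight w) {s : Set (Fin d → ℝ)}
    (hs : MeasurableSet s) (g : (Fin d → ℝ) → ℂ) :
    ∫ x in s, ‖(w x : ℂ) * g x‖ = ∫ x in s, ‖g x‖ ∂(weightMeasure w) := by
  unfold weightMeasure
  rw [restrict_withDensity hs, integral_withDensity_eq_integral_toReal_smul₀
    hw.aemeasurable.restrict (ae_of_all _ fun _ => ENNReal.ofReal_lt_top)]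
  simp only [hw.toReal_ofReal, norm_mul, Complex.norm_real, smul_eq_mul,
    Real.norm_of_nonneg (hw.nonneg _)]

lemma IsWeight.integral_mul {w : (Fin d → ℝ) → ℝ} (hw : IsWeight w) (g : (Fin d → ℝ) → ℂ) :
    ∫ x, (w x : ℂ) * g x = ∫ x, g x ∂(weightMeasure w) := by
  unfold weightMeasure
  rw [integral_withDensity_eq_integral_toReal_smul₀
    hw.aemeasurable (ae_of_all _ fun _ => ENNReal.ofReal_lt_top)]
  simp only [hw.toReal_ofReal, Complex.real_smul]

lemma integrableOn_toSet_of_memLp {μ : Measure (Fin d → ℝ)} {Q : DyadicCube d}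
    (hμ : μ (Q.toSet ω) ≠ ∞) {g : (Fin d → ℝ) → ℂ} (hg : MemLp g 2 μ) :
    IntegrableOn g (Q.toSet ω) μ := by
  have : IsFiniteMeasure (μ.restrict (Q.toSet ω)) := ⟨by
    rw [Measure.restrict_apply_univ]; exact hμ.lt_top⟩
  exact (hg.restrict _).integrable one_le_two

lemma IsWeight.integrableOnCubes {w : (Fin d → ℝ) → ℝ} (hw : IsWeight w)
    {g : (Fin d → ℝ) → ℂ} (hg : MemLp g 2 (weightMeasure w)) :
    IntegrableOnCubes ω fun x => (w x : ℂ) * g x := fun Q =>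
  (hw.integrableOn_iff (measurableSet_toSet Q)).mp
    (integrableOn_toSet_of_memLp (hw.measure_ne_top Q) hg)

/-- For `S ⊆ F` the average `w(S)/|S|` is at most `M(w 1_F)` on `S`, so Carleson packing bounds the
sum by `2 ∫_F M(w 1_F)`, which is what the `A_∞` characteristic measures. -/
lemma sum_le_charAInfty {w : (Fin d → ℝ) → ℝ} (hw : IsWeight w) (hfin : charAInfty ω w < ∞)
    {𝓢 𝓣 : Finset (DyadicCube d)} (h𝓢 : IsSparse ω 𝓢) (h𝓣 : 𝓣 ⊆ 𝓢) {F : DyadicCube d}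
    (hF : ∀ S ∈ 𝓣, S.toSet ω ⊆ F.toSet ω) :
    ∑ S ∈ 𝓣, (weightMeasure w).real (S.toSet ω) ≤
      2 * (charAInfty ω w).toReal * (weightMeasure w).real (F.toSet ω) := by
  set ν := weightMeasure w with hν
  have hFtop : ν (F.toSet ω) ≠ ∞ := hw.measure_ne_top F
  have main : ∑ S ∈ 𝓣, ν (S.toSet ω) ≤ 2 * charAInfty ω w * ν (F.toSet ω) := by
    by_cases h0 : ν (F.toSet ω) = 0
    · rw [Finset.sum_eq_zero fun S hS => measure_mono_null (hF S hS) h0]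
      exact zero_le
    have h1 := h𝓢.sum_mul_volume_le h𝓣 hF (c := fun S => ν (S.toSet ω) / volume (S.toSet ω))
      (g := dyadicMaximal ω w F) fun S hS x hx => by
        unfold dyadicMaximal
        refine le_trans (le_of_eq ?_) (le_iSup₂ (f := fun (R : DyadicCube d)
          (_ : x ∈ R.toSet ω) => weightMeasure w (R.toSet ω ∩ F.toSet ω) /
            volume (R.toSet ω)) S hx)
        rw [Set.inter_eq_left.mpr (hF S hS)]
    have h2 : ∫⁻ x in F.toSet ω, dyadicMaximal ω w F x ≤ charAInfty ω w * ν (F.toSet ω) := by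
      rw [← ENNReal.div_le_iff h0 hFtop]
      exact le_iSup (fun Q : DyadicCube d =>
        (∫⁻ x in Q.toSet ω, dyadicMaximal ω w Q x) / weightMeasure w (Q.toSet ω)) F
    calc ∑ S ∈ 𝓣, ν (S.toSet ω) =
          ∑ S ∈ 𝓣, ν (S.toSet ω) / volume (S.toSet ω) * volume (S.toSet ω) := by
          refine Finset.sum_congr rfl fun S _ => ?_
          rw [ENNReal.div_mul_cancel (volume_ne_zero S) (volume_ne_top S)]
      _ ≤ 2 * (charAInfty ω w * ν (F.toSet ω)) := h1.trans (by gcongr)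
      _ = _ := by ring
  have h3 := ENNReal.toReal_mono
    (ENNReal.mul_ne_top (ENNReal.mul_ne_top (by simp) hfin.ne) hFtop) main
  rw [ENNReal.toReal_sum fun S _ => hw.measure_ne_top S, ENNReal.toReal_mul,
    ENNReal.toReal_mul] at h3
  simpa [measureReal_def] using h3

lemma mul_le_jointA2 {w σ : (Fin d → ℝ) → ℝ} (hfin : jointA2 ω w σ < ∞) (Q : DyadicCube d) :
    (weightMeasure w).real (Q.toSet ω) * (weightMeasure σ).real (Q.toSet ω) ≤
      (jointA2 ω w σ).toReal * volume.real (Q.toSet ω) ^ 2 := by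
  have h1 : weightMeasure w (Q.toSet ω) * weightMeasure σ (Q.toSet ω) ≤
      jointA2 ω w σ * volume (Q.toSet ω) ^ 2 := by
    rw [← ENNReal.div_le_iff (pow_ne_zero 2 (volume_ne_zero Q))
      (ENNReal.pow_ne_top (volume_ne_top Q))]
    exact le_iSup (fun Q : DyadicCube d => weightMeasure w (Q.toSet ω) *
      weightMeasure σ (Q.toSet ω) / volume (Q.toSet ω) ^ 2) Q
  have h2 := ENNReal.toReal_mono
    (ENNReal.mul_ne_top hfin.ne (ENNReal.pow_ne_top (volume_ne_top Q))) h1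
  simpa [measureReal_def, ENNReal.toReal_mul] using h2

/-! ### The estimate for finite partial sums -/

lemma memLp_avgOp {μ : Measure (Fin d → ℝ)} (hμ : ∀ Q : DyadicCube d, μ (Q.toSet ω) ≠ ∞)
    (i j : ℕ) (a : Coefficients d) (K : DyadicCube d) (φ : (Fin d → ℝ) → ℂ) :
    MemLp (avgOp ω i j a K φ) 2 μ := by
  have hh : ∀ (J : DyadicCube d) (θ : Fin d → Fin 2),
      MemLp (fun x => (haar ω J θ x : ℂ)) 2 μ := by
    intro J θ
    have : (fun x => (haar ω J θ x : ℂ)) = (J.toSet ω).indicator fun x => (haar ω J θ x : ℂ) := by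
      ext x
      by_cases hx : x ∈ J.toSet ω
      · simp [hx]
      · simp [hx, haar_eq_zero hx]
    rw [this, memLp_indicator_iff_restrict (measurableSet_toSet J)]
    have : IsFiniteMeasure (μ.restrict (J.toSet ω)) := ⟨by
      rw [Measure.restrict_apply_univ]; exact (hμ J).lt_top⟩
    refine MemLp.of_bound (Complex.measurable_ofReal.comp
      (measurable_haar J θ)).aestronglyMeasurable (√(volume.real (J.toSet ω)))⁻¹ ?_
    filter_upwards with x
    simpa using abs_haar_le J θ x
  unfold avgOp
  exact memLp_finsetSum _ fun I _ => memLp_finsetSum _ fun J _ => memLp_finsetSum _ fun η _ =>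
    memLp_finsetSum _ fun θ _ => (hh J θ).const_mul _

lemma toReal_eLpNorm_two {μ : Measure (Fin d → ℝ)} {g : (Fin d → ℝ) → ℂ} (hg : MemLp g 2 μ) :
    (eLpNorm g 2 μ).toReal = √(∫ x, ‖g x‖ ^ 2 ∂μ) := by
  rw [hg.eLpNorm_eq_integral_rpow_norm (by simp) (by simp), ENNReal.toReal_ofReal (by positivity)]
  simp [Real.sqrt_eq_rpow]

lemma integrable_sq_norm {μ : Measure (Fin d → ℝ)} {g : (Fin d → ℝ) → ℂ} (hg : MemLp g 2 μ) :
    Integrable (fun x => ‖g x‖ ^ 2) μ :=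
  (memLp_two_iff_integrable_sq_norm hg.aestronglyMeasurable).mp hg

/-- The constant in the weighted bound. -/
noncomputable def weightedConst (ω : ℤ → Fin d → Fin 2) (i j : ℕ) (w σ : (Fin d → ℝ) → ℝ) : ℝ :=
  64 * 8 ^ d * (1 + (max i j : ℕ)) * (48 * √(jointA2 ω w σ).toReal *
    (√(charAInfty ω w).toReal + √(charAInfty ω σ).toReal))

lemma weightedConst_nonneg (i j : ℕ) (w σ : (Fin d → ℝ) → ℝ) :
    0 ≤ weightedConst ω i j w σ := by
  unfold weightedConst; positivity

/-- The dual function is the conjugate of `G` itself, so the form equals the square of the norm of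
`G`. The sparse estimates bound it by a constant times the norms of `f` and of `G`. The latter is
finite for a finite sum, so one factor can be cancelled. -/
lemma eLpNorm_sum_avgOp_le [NeZero d] {i j : ℕ} {a : Coefficients d}
    (ha : IsDyadicShift ω i j a) {w σ : (Fin d → ℝ) → ℝ} (hw : IsWeight w) (hσ : IsWeight σ)
    (hwA : charAInfty ω w < ∞) (hσA : charAInfty ω σ < ∞) (hA : jointA2 ω w σ < ∞)
    {f : (Fin d → ℝ) → ℂ} (hf : MemLp f 2 (weightMeasure σ)) (𝒬 : Finset (DyadicCube d)) :
    (eLpNorm (fun x => ∑ K ∈ 𝒬, avgOp ω i j a K (fun x => (σ x : ℂ) * f x) x) 2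
      (weightMeasure w)).toReal ≤
      weightedConst ω i j w σ * (eLpNorm f 2 (weightMeasure σ)).toReal := by
  set φ : (Fin d → ℝ) → ℂ := fun x => (σ x : ℂ) * f x with hφdef
  set G : (Fin d → ℝ) → ℂ := fun x => ∑ K ∈ 𝒬, avgOp ω i j a K φ x with hG
  have hGm : MemLp G 2 (weightMeasure w) :=
    memLp_finsetSum _ fun K _ => memLp_avgOp (fun Q => hw.measure_ne_top Q) i j a K φ
  set H : (Fin d → ℝ) → ℂ := fun x => (starRingEnd ℂ) (G x) with hH
  have hHm : MemLp H 2 (weightMeasure w) :=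
    hGm.of_le (Complex.continuous_conj.comp_aestronglyMeasurable hGm.aestronglyMeasurable)
      (ae_of_all _ fun x => by simp [hH])
  set ψ : (Fin d → ℝ) → ℂ := fun x => (w x : ℂ) * H x with hψdef
  have hφ : IntegrableOnCubes ω φ := hσ.integrableOnCubes hf
  have hψ : IntegrableOnCubes ω ψ := hw.integrableOnCubes hHm
  have hform : ∑ K ∈ 𝒬, avgForm ω i j a K φ ψ =
      ((∫ x, ‖G x‖ ^ 2 ∂(weightMeasure w) : ℝ) : ℂ) := by
    simp only [← (integrable_avgOp_mul hψ i j a _ φ).2]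
    rw [← integral_finsetSum _ fun K _ => (integrable_avgOp_mul hψ i j a K φ).1,
      ← integral_complex_ofReal, ← hw.integral_mul]
    congr 1
    ext x
    rw [← Finset.sum_mul, hψdef, Complex.ofReal_pow, ← Complex.mul_conj']
    simp only [hH, hG]
    ring
  obtain ⟨𝓢, h𝓢, hle⟩ := exists_sparse_bound ha hφ hψ 𝒬
  have hsp := sum_sparse_le h𝓢 (fun Q => hw.measure_ne_top Q) (fun Q => hσ.measure_ne_top Q)
    ENNReal.toReal_nonneg ENNReal.toReal_nonneg ENNReal.toReal_nonneg
    (fun Q => mul_le_jointA2 hA Q)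
    (fun F 𝓣 h1 h2 => sum_le_charAInfty hw hwA h𝓢 h1 h2)
    (fun F 𝓣 h1 h2 => sum_le_charAInfty hσ hσA h𝓢 h1 h2)
    (f := fun x => ‖f x‖) (g := fun x => ‖H x‖) (fun _ => norm_nonneg _) (fun _ => norm_nonneg _)
    (fun Q => (integrableOn_toSet_of_memLp (hσ.measure_ne_top Q) hf).norm)
    (fun Q => (integrableOn_toSet_of_memLp (hw.measure_ne_top Q) hHm).norm)
    (integrable_sq_norm hf) (integrable_sq_norm hHm)
  have hnH : ∀ x, ‖H x‖ = ‖G x‖ := fun x => by simp [hH]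
  have hI0 : 0 ≤ ∫ x, ‖G x‖ ^ 2 ∂(weightMeasure w) := integral_nonneg fun _ => sq_nonneg _
  rw [hform, Complex.norm_real, Real.norm_of_nonneg hI0] at hle
  have hpieces : ∀ S : DyadicCube d, (∫ x in S.toSet ω, ‖φ x‖) * (∫ x in S.toSet ω, ‖ψ x‖) =
      (∫ x in S.toSet ω, ‖f x‖ ∂(weightMeasure σ)) *
        ∫ x in S.toSet ω, ‖H x‖ ∂(weightMeasure w) := fun S => by
    rw [hσ.setIntegral_norm (measurableSet_toSet S), hw.setIntegral_norm (measurableSet_toSet S)]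
  simp only [hpieces] at hle
  rw [toReal_eLpNorm_two hf, toReal_eLpNorm_two hGm]
  set X := √(∫ x, ‖G x‖ ^ 2 ∂(weightMeasure w)) with hX
  set Y := √(∫ x, ‖f x‖ ^ 2 ∂(weightMeasure σ)) with hY
  have hX2 : ∫ x, ‖G x‖ ^ 2 ∂(weightMeasure w) = X * X := (Real.mul_self_sqrt hI0).symm
  simp only [hnH] at hsp
  rw [← hX] at hsp
  have hfinal : X * X ≤ weightedConst ω i j w σ * Y * X := by
    rw [← hX2]
    refine hle.trans ?_
    simp only [hnH]
    refine (mul_le_mul_of_nonneg_left hsp (by positivity)).trans (le_of_eq ?_)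
    unfold weightedConst
    ring
  have hX0 : 0 ≤ X := Real.sqrt_nonneg _
  rcases hX0.eq_or_lt with h0 | hpos
  · rw [← h0]
    exact mul_nonneg (weightedConst_nonneg i j w σ) (Real.sqrt_nonneg _)
  · exact le_of_mul_le_mul_right hfinal hpos

/-! ### Unconditional convergence -/

/-- In a Hilbert space, a series with bounded finite partial sums converges unconditionally. -/
lemma summable_of_norm_sum_le {ι E : Type*} [NormedAddCommGroup E] [InnerProductSpace ℂ E]
    [CompleteSpace E] {x : ι → E} {N : ℝ} (h : ∀ s : Finset ι, ‖∑ i ∈ s, x i‖ ≤ N) :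
    Summable x := by
  classical
  rw [summable_iff_vanishing_norm]
  intro ε hε
  -- Differences `v` of two partial sums are taken with `‖v‖²` within `ε²` of the supremum. For `u`
  -- disjoint from both index sets and `y = ∑_u x`, both `v + y` and `v - y` are again such
  -- differences, so the parallelogram law forces `‖y‖² < ε²`.
  let B : Set ℝ := {r | ∃ s t : Finset ι, r = ‖∑ i ∈ s, x i - ∑ i ∈ t, x i‖ ^ 2}
  have hB : BddAbove B := by
    refine ⟨(N + N) ^ 2, ?_⟩
    rintro r ⟨s, t, rfl⟩
    exact pow_le_pow_left₀ (norm_nonneg _)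
      ((norm_sub_le _ _).trans (add_le_add (h s) (h t))) 2
  have hne : B.Nonempty := ⟨_, ∅, ∅, rfl⟩
  obtain ⟨r, ⟨s, t, rfl⟩, hr⟩ := exists_lt_of_lt_csSup hne
    (sub_lt_self (sSup B) (by positivity : 0 < ε ^ 2))
  refine ⟨s ∪ t, fun u hu => ?_⟩
  rw [Finset.disjoint_union_right] at hu
  have h1 : ‖∑ i ∈ s ∪ u, x i - ∑ i ∈ t, x i‖ ^ 2 ≤ sSup B := le_csSup hB ⟨s ∪ u, t, rfl⟩
  have h2 : ‖∑ i ∈ s, x i - ∑ i ∈ t ∪ u, x i‖ ^ 2 ≤ sSup B := le_csSup hB ⟨s, t ∪ u, rfl⟩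
  rw [Finset.sum_union hu.1.symm] at h1
  rw [Finset.sum_union hu.2.symm] at h2
  have hp := parallelogram_law_with_norm ℂ (∑ i ∈ s, x i - ∑ i ∈ t, x i) (∑ i ∈ u, x i)
  have e1 : ∑ i ∈ s, x i + ∑ i ∈ u, x i - ∑ i ∈ t, x i =
      ∑ i ∈ s, x i - ∑ i ∈ t, x i + ∑ i ∈ u, x i := by abel
  have e2 : ∑ i ∈ s, x i - (∑ i ∈ t, x i + ∑ i ∈ u, x i) =
      ∑ i ∈ s, x i - ∑ i ∈ t, x i - ∑ i ∈ u, x i := by abel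
  rw [e1] at h1
  rw [e2] at h2
  refine lt_of_pow_lt_pow_left₀ 2 hε.le ?_
  linarith

lemma coeFn_sum_toLp {ι : Type*} {μ : Measure (Fin d → ℝ)} {u : ι → (Fin d → ℝ) → ℂ}
    (hu : ∀ i, MemLp (u i) 2 μ) (s : Finset ι) :
    (∑ i ∈ s, (hu i).toLp (u i) : Lp ℂ 2 μ) =ᵐ[μ] fun x => ∑ i ∈ s, u i x := by
  classical
  induction s using Finset.induction_on with
  | empty =>
    simp only [Finset.sum_empty]
    exact Lp.coeFn_zero ℂ 2 μ
  | insert i s hi ih =>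
    simp only [Finset.sum_insert hi]
    filter_upwards [Lp.coeFn_add ((hu i).toLp (u i)) (∑ i ∈ s, (hu i).toLp (u i)), ih,
      (hu i).coeFn_toLp] with x h1 h2 h3
    rw [h1, Pi.add_apply, h2, h3]

lemma avgOp_eq_haarCoeff (i j : ℕ) (a : Coefficients d) (K : DyadicCube d)
    (φ : (Fin d → ℝ) → ℂ) (x : Fin d → ℝ) :
    avgOp ω i j a K φ x = ∑ I ∈ descendants ω i K, ∑ J ∈ descendants ω j K,
      ∑ η : Fin d → Fin 2, ∑ θ : Fin d → Fin 2,
        a I J K η θ * haarCoeff ω φ I η * (haar ω J θ x : ℂ) := rfl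

/-- Representatives in `L²(σ)` agree only almost everywhere for `σ`; written against that measure,
the coefficient does not depend on the representative. -/
lemma haarCoeff_weight {σ : (Fin d → ℝ) → ℝ} (hσ : IsWeight σ) (f : (Fin d → ℝ) → ℂ)
    (I : DyadicCube d) (η : Fin d → Fin 2) :
    haarCoeff ω (fun x => (σ x : ℂ) * f x) I η =
      ∫ x, f x * (haar ω I η x : ℂ) ∂(weightMeasure σ) := by
  rw [← hσ.integral_mul]
  simp only [haarCoeff, mul_assoc]

lemma integrable_mul_haar_weight {σ : (Fin d → ℝ) → ℝ} (hσ : IsWeight σ)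
    {f : (Fin d → ℝ) → ℂ} (hf : MemLp f 2 (weightMeasure σ)) (I : DyadicCube d)
    (η : Fin d → Fin 2) :
    Integrable (fun x => f x * (haar ω I η x : ℂ)) (weightMeasure σ) := by
  rw [mul_haar_eq_indicator, integrable_indicator_iff (measurableSet_toSet I)]
  refine Integrable.mul_bdd (c := (√(volume.real (I.toSet ω)))⁻¹)
    (integrableOn_toSet_of_memLp (hσ.measure_ne_top I) hf)
    (Complex.measurable_ofReal.comp (measurable_haar I η)).aestronglyMeasurable ?_
  filter_upwards with y
  simpa using abs_haar_le I η y

/-- The operator `f ↦ A_K(σ f)` from `L²(σ)` to `L²(w)`. -/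
noncomputable def weightedAvgOp (i j : ℕ) (a : Coefficients d) {w σ : (Fin d → ℝ) → ℝ}
    (hw : IsWeight w) (hσ : IsWeight σ) (K : DyadicCube d) :
    Lp ℂ 2 (weightMeasure σ) →ₗ[ℂ] Lp ℂ 2 (weightMeasure w) where
  toFun f := (memLp_avgOp (ω := ω) (fun Q => hw.measure_ne_top Q) i j a K
    fun x => (σ x : ℂ) * f x).toLp _
  map_add' f g := by
    rw [← MemLp.toLp_add]
    refine MemLp.toLp_congr _ _ (ae_of_all _ fun x => ?_)
    have hc : ∀ I η, haarCoeff ω (fun x => (σ x : ℂ) * (f + g : Lp ℂ 2 (weightMeasure σ)) x) I η =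
        haarCoeff ω (fun x => (σ x : ℂ) * f x) I η +
          haarCoeff ω (fun x => (σ x : ℂ) * g x) I η := by
      intro I η
      rw [haarCoeff_weight hσ, haarCoeff_weight hσ, haarCoeff_weight hσ, ← integral_add
        (integrable_mul_haar_weight hσ (Lp.memLp f) I η)
        (integrable_mul_haar_weight hσ (Lp.memLp g) I η)]
      refine integral_congr_ae ?_
      filter_upwards [Lp.coeFn_add f g] with x hx
      rw [hx, Pi.add_apply, add_mul]
    rw [Pi.add_apply]
    simp only [avgOp_eq_haarCoeff, hc, mul_add, add_mul, Finset.sum_add_distrib]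
  map_smul' c f := by
    rw [RingHom.id_apply, ← MemLp.toLp_const_smul]
    refine MemLp.toLp_congr _ _ (ae_of_all _ fun x => ?_)
    have hc : ∀ I η, haarCoeff ω (fun x => (σ x : ℂ) * (c • f : Lp ℂ 2 (weightMeasure σ)) x) I η =
        c * haarCoeff ω (fun x => (σ x : ℂ) * f x) I η := by
      intro I η
      rw [haarCoeff_weight hσ, haarCoeff_weight hσ, ← integral_const_mul]
      refine integral_congr_ae ?_
      filter_upwards [Lp.coeFn_smul c f] with x hx
      rw [hx, Pi.smul_apply, smul_eq_mul, mul_assoc]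
    rw [Pi.smul_apply, smul_eq_mul]
    simp only [avgOp_eq_haarCoeff, hc, Finset.mul_sum]
    refine Finset.sum_congr rfl fun I _ => Finset.sum_congr rfl fun J _ =>
      Finset.sum_congr rfl fun η _ => Finset.sum_congr rfl fun θ _ => ?_
    ring

lemma coeFn_sum_weightedAvgOp (i j : ℕ) (a : Coefficients d) {w σ : (Fin d → ℝ) → ℝ}
    (hw : IsWeight w) (hσ : IsWeight σ) (f : Lp ℂ 2 (weightMeasure σ)) {𝒬 : Set (DyadicCube d)}
    (F : Finset 𝒬) :
    (∑ K ∈ F, weightedAvgOp (ω := ω) i j a hw hσ K f : Lp ℂ 2 (weightMeasure w))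
      =ᵐ[weightMeasure w] fun x => ∑ K ∈ F, avgOp ω i j a K (fun x => (σ x : ℂ) * f x) x :=
  coeFn_sum_toLp (fun K : 𝒬 => memLp_avgOp (ω := ω) (fun Q => hw.measure_ne_top Q) i j a K
    fun x => (σ x : ℂ) * f x) F

lemma norm_sum_weightedAvgOp_le [NeZero d] {i j : ℕ} {a : Coefficients d}
    (ha : IsDyadicShift ω i j a) {w σ : (Fin d → ℝ) → ℝ} (hw : IsWeight w) (hσ : IsWeight σ)
    (hwA : charAInfty ω w < ∞) (hσA : charAInfty ω σ < ∞) (hA : jointA2 ω w σ < ∞)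
    (f : Lp ℂ 2 (weightMeasure σ)) {𝒬 : Set (DyadicCube d)} (F : Finset 𝒬) :
    ‖∑ K ∈ F, weightedAvgOp (ω := ω) i j a hw hσ K f‖ ≤ weightedConst ω i j w σ * ‖f‖ := by
  rw [Lp.norm_def, Lp.norm_def, eLpNorm_congr_ae (coeFn_sum_weightedAvgOp i j a hw hσ f F)]
  have := eLpNorm_sum_avgOp_le ha hw hσ hwA hσA hA (Lp.memLp f)
    (F.map (Function.Embedding.subtype _))
  simpa only [Finset.sum_map, Function.Embedding.coe_subtype] using this

end DyadicShift

/-! ### Summation of the series and the weighted norm bound -/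

open DyadicShift in
theorem mainTheorem6 (d : ℕ) (hd : 0 < d) :
    ∃ C : ℝ, 0 ≤ C ∧
      ∀ (ω : ℤ → Fin d → Fin 2) (i j : ℕ) (a : DyadicShift.Coefficients d),
        DyadicShift.IsDyadicShift ω i j a →
      ∀ w σ : (Fin d → ℝ) → ℝ,
        DyadicShift.IsWeight w → DyadicShift.IsWeight σ →
        DyadicShift.charAInfty ω w < ∞ → DyadicShift.charAInfty ω σ < ∞ →
        DyadicShift.jointA2 ω w σ < ∞ →
      ∃ T : Lp ℂ 2 (DyadicShift.weightMeasure σ) →L[ℂ] Lp ℂ 2 (DyadicShift.weightMeasure w),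
        (∀ f : Lp ℂ 2 (DyadicShift.weightMeasure σ),
          DyadicShift.HasL2Sum (DyadicShift.weightMeasure w) Set.univ
            (fun K => DyadicShift.avgOp ω i j a K (fun x => (σ x : ℂ) * f x)) (T f)) ∧
        ‖T‖ ≤ C * (1 + (max i j : ℕ)) ^ 2 * √(DyadicShift.jointA2 ω w σ).toReal *
          (√(DyadicShift.charAInfty ω w).toReal + √(DyadicShift.charAInfty ω σ).toReal) := by
  have : NeZero d := ⟨hd.ne'⟩
  -- `64 * 8 ^ d` comes from sparse domination and `48` from the two-weight bound for sparse forms.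
  refine ⟨64 * 8 ^ d * 48, by positivity, ?_⟩
  intro ω i j a ha w σ hw hσ hwA hσA hA
  let X : ↥(Set.univ : Set (DyadicCube d)) →
      Lp ℂ 2 (weightMeasure σ) →ₗ[ℂ] Lp ℂ 2 (weightMeasure w) :=
    fun K => weightedAvgOp (ω := ω) i j a hw hσ K
  have hbound : ∀ f (F : Finset (Set.univ : Set (DyadicCube d))),
      ‖∑ K ∈ F, X K f‖ ≤ weightedConst ω i j w σ * ‖f‖ :=
    fun f F => norm_sum_weightedAvgOp_le ha hw hσ hwA hσA hA f F
  have hsum : ∀ f, Summable fun K => X K f := fun f => summable_of_norm_sum_le (hbound f)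
  let L : Lp ℂ 2 (weightMeasure σ) →ₗ[ℂ] Lp ℂ 2 (weightMeasure w) :=
    { toFun := fun f => ∑' K, X K f
      map_add' := fun f g => by
        simp only [map_add]
        exact (hsum f).tsum_add (hsum g)
      map_smul' := fun c f => by
        simp only [map_smul, RingHom.id_apply]
        exact (hsum f).tsum_const_smul c }
  -- The bound is uniform in the finite index set, so it passes to the sum of the series.
  have hL : ∀ f, ‖L f‖ ≤ weightedConst ω i j w σ * ‖f‖ := fun f =>
    le_of_tendsto (hsum f).hasSum.norm (Eventually.of_forall (hbound f))
  refine ⟨L.mkContinuous _ hL, fun f => ⟨fun K _ => ?_, Lp.memLp _, ?_⟩, ?_⟩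
  · exact memLp_avgOp (fun Q => hw.measure_ne_top Q) i j a K _
  · have hlim := (Lp.tendsto_Lp_iff_tendsto_eLpNorm' _ _).mp (hsum f).hasSum
    refine hlim.congr fun F => ?_
    rw [eLpNorm_sub_comm]
    refine eLpNorm_congr_ae ?_
    filter_upwards [coeFn_sum_weightedAvgOp (ω := ω) i j a hw hσ f F] with x hx
    rw [Pi.sub_apply, hx]
    rfl
  · refine (L.mkContinuous_norm_le (weightedConst_nonneg i j w σ) hL).trans ?_
    unfold weightedConst
    -- The argument yields linear growth in `1 + κ`, which is weakened here to the square.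
    have h1 : (1 + ((max i j : ℕ) : ℝ)) ≤ (1 + ((max i j : ℕ) : ℝ)) ^ 2 := by
      have : (0 : ℝ) ≤ ((max i j : ℕ) : ℝ) := Nat.cast_nonneg _
      nlinarith
    calc _ ≤ 64 * 8 ^ d * (1 + ((max i j : ℕ) : ℝ)) ^ 2 * (48 * √(jointA2 ω w σ).toReal *
          (√(charAInfty ω w).toReal + √(charAInfty ω σ).toReal)) := by gcongr
      _ = _ := by ring
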